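/- Fix a nonnegative $\Phi\in C^\infty(\mathbb{R}^2)$ with compact support and $\int_{\mathbb{R}^2}\Phi=1$, a real number $\theta$, and a positive integer $n$. Put $\phi:=\sqrt{\Phi}$, and for small $\varepsilon>0$ let $$\beta_\varepsilon:=\frac{2\pi}{|\log\varepsilon|}+\frac{\pi}{|\log\varepsilon|^2}\Big(\theta-2\log 2+2\gamma+2\int_{\mathbb{R}^4}\Phi(x)\log|x-x'|\,\Phi(x')\,dx\,dx'\Big),$$ where $\gamma$ is the Euler–Mascheroni constant. Let $p(t,x):=\frac{1}{2\pi t}e^{-|x|^2/(2t)}$ be the heat kernel on $\mathbb{R}^2$ and $\mathcal{P}(t,x):=\prod_{k=1}^n p(t,x_k)$ the heat kernel on $(\mathbb{R}^2)^n$. For a pair $\alpha=\{i<j\}\subset\{1,\dots,n\}$, write the points of $\Omega_\alpha:=\mathbb{R}^2\times\mathbb{R}^2\times(\mathbb{R}^2)^{\{1,\dots,n\}\setminus\alpha}$ as $y=(y_{\mathrm r},y_{\mathrm c},(y_k)_{k\notin\alpha})$, and let $S^\varepsilon_\alpha y\in(\mathbb{R}^2)^n$ have components $y_{\mathrm c}+\varepsilon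 y_{\mathrm r}/2$ at $i$, $y_{\mathrm c}-\varepsilon y_{\mathrm r}/2$ at $j$, and $y_k$ at $k\notin\alpha$. For $t>0$ let $\mathcal{P}^\varepsilon_\alpha(t):L^2((\mathbb{R}^2)^n)\to L^2(\Omega_\alpha)$ and $\mathcal{P}^\varepsilon_{\alpha\alpha'}(t):L^2(\Omega_{\alpha'})\to L^2(\Omega_\alpha)$ be the integral operators with kernels $$\mathcal{P}^\varepsilon_\alpha(t,y,x):=\phi(y_{\mathrm r})\,\mathcal{P}(t,S^\varepsilon_\alpha y-x),\qquad \mathcal{P}^\varepsilon_{\alpha\alpha'}(t,y,y'):=\phi(y_{\mathrm r})\,\mathcal{P}(t,S^\varepsilon_\alpha y-S^\varepsilon_{\alpha'}y')\,\phi(y'_{\mathrm r}),$$ let $\mathcal{P}^\varepsilon_\alpha(t)^*$ be the integral operator with the transposed kernel $(x,y)\mapsto\mathcal{P}^\varepsilon_\alpha(t,y,x)$, and let $\int_0^\infty dt\,e^{-t}\mathcal{P}^\varepsilon_{\alpha\alpha'}(t)$ be the integral operator with kernel $\int_0^\infty dt\,e^{-t}\mathcal{P}^\varepsilon_{\alpha\alpha'}(t,y,y')$.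 Finally, let $\phi\,p_\varepsilon(2\tau)\,\phi$ be the integral operator on $L^2(\mathbb{R}^2)$ with kernel $\phi(y)\,p(2\tau,\varepsilon(y-y'))\,\phi(y')$, and let $$\mathsf{j}^\varepsilon(t):=\sum_{\ell=1}^\infty\beta_\varepsilon^{\ell+1}\int_{\tau_1+\dots+\tau_\ell=t}d\vec\tau\;\prod_{k=1}^{\ell}\phi\,p_\varepsilon(2\tau_k)\,\phi ,$$ where the integral over $\tau_1,\dots,\tau_\ell>0$ is the $\ell$-fold convolution in time. Then there is a constant $c\in(0,\infty)$, depending only on $\theta$, $n$ and $\Phi$, such that for all $\varepsilon\in(0,1/c]$ the following operators are well defined and bounded between the (unweighted) $L^2$ spaces, the series for $\mathsf{j}^\varepsilon(t)$ converges in operator norm, and their operator norms satisfy: 1. $\|\mathcal{P}^\varepsilon_\alpha(t)\|=\|\mathcal{P}^\varepsilon_\alpha(t)^*\|\le c\,t^{-1/2}$ for all $t>0$ and all pairs $\alpha$; 2. $\|\mathcal{P}^\varepsilon_{\alpha\alpha'}(t)\|\le c\,t^{-1}$ for all $t>0$ and all pairs $\alpha,\alpha'$; 3. $\big\|\int_0^\infty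 dt\,e^{-t}\,\mathcal{P}^\varepsilon_{\alpha\alpha'}(t)\big\|\le c$ for all pairs $\alpha\neq\alpha'$; 4. $\|\mathsf{j}^\varepsilon(t)\|\le c\,t^{-1}\,\big|\log\big(t\wedge\tfrac12\big)\big|^{-2}\,e^{ct}$ for all $t>0$. -/

import Mathlib

open MeasureTheory
open scoped ENNReal ContDiff

namespace DeltaBose

noncomputable section

/-- The plane `ℝ²` with its Euclidean norm and Lebesgue measure. -/
abbrev Plane := EuclideanSpace ℝ (Fin 2)

/-- The `n`-particle configuration space `(ℝ²)ⁿ`, with Lebesgue measure. -/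
abbrev Config (n : ℕ) := Fin n → Plane

/-- Unordered pairs `α = {i < j}` of particle labels, recorded in increasing order. -/
abbrev Pair (n : ℕ) := {p : Fin n × Fin n // p.1 < p.2}

/-- The labels that do not belong to the pair `α`. -/
abbrev Rest {n : ℕ} (α : Pair n) := {k : Fin n // k ≠ α.1.1 ∧ k ≠ α.1.2}

/-- The space `ℝ⁴ × (ℝ²)^(rest of α)` of points `y = (y_r, y_c, (y_k)_k)`, where `y_r` is the
relative coordinate and `y_c` is the center of mass, with Lebesgue measure. -/
abbrev RelConfig {n : ℕ} (α : Pair n) := Plane × Plane × (Rest α → Plane)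

/-- The map `S^ε_α`: particle `i` is put at `y_c + ε y_r / 2`, particle `j` at
`y_c - ε y_r / 2`, and every other particle `k` at `y_k`, where `α = {i < j}`. -/
def S {n : ℕ} (ε : ℝ) (α : Pair n) (y : RelConfig α) : Config n := fun k =>
  if hi : k = α.1.1 then y.2.1 + (ε / 2) • y.1
  else if hj : k = α.1.2 then y.2.1 - (ε / 2) • y.1
  else y.2.2 ⟨k, hi, hj⟩

/-- The heat kernel on `ℝ²`. -/
def hk (t : ℝ) (x : Plane) : ℝ :=
  Real.exp (-‖x‖ ^ 2 / (2 * t)) / (2 * Real.pi * t)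

/-- The heat kernel on `(ℝ²)ⁿ`. -/
def heat {n : ℕ} (t : ℝ) (x : Config n) : ℝ := ∏ i, hk t (x i)

/-- `φ = √Φ`. -/
def phi (Φ : Plane → ℝ) (x : Plane) : ℝ := Real.sqrt (Φ x)

/-- The coupling constant `β_ε`. -/
def beta (Φ : Plane → ℝ) (θ ε : ℝ) : ℝ :=
  2 * Real.pi / |Real.log ε| +
    Real.pi / |Real.log ε| ^ 2 *
      (θ - 2 * Real.log 2 + 2 * Real.eulerMascheroniConstant +
        2 * ∫ p : Plane × Plane, Φ p.1 * Real.log ‖p.1 - p.2‖ * Φ p.2)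

/-- The bounded operator `T : L²(Y) → L²(X)` (complex-valued functions) is the integral operator
with the nonnegative kernel `K`: for every `f`, the integral defining `(T f) x` converges
absolutely for almost every `x`, and `(T f) x = ∫ K(x, y) f(y) dy`. -/
def HasKernel {X Y : Type*} [MeasureSpace X] [MeasureSpace Y] (K : X → Y → ℝ≥0∞)
    (T : Lp ℂ 2 (volume : Measure Y) →L[ℂ] Lp ℂ 2 (volume : Measure X)) : Prop :=
  ∀ f : Lp ℂ 2 (volume : Measure Y), ∀ᵐ x : X,
    (∫⁻ y, K x y * ‖f y‖ₑ) < (⊤ : ℝ≥0∞) ∧ T f x = ∫ y, ((K x y).toReal : ℂ) * f y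

/-- The kernel of `𝒫^ε_α(t)`, from functions on `(ℝ²)ⁿ` to functions on
`ℝ⁴ × (ℝ²)^(rest of α)`. -/
def incoming (Φ : Plane → ℝ) {n : ℕ} (ε : ℝ) (α : Pair n) (t : ℝ)
    (y : RelConfig α) (x : Config n) : ℝ≥0∞ :=
  ENNReal.ofReal (phi Φ y.1 * heat t (S ε α y - x))

/-- The kernel of `𝒫^ε_α(t)^*`. -/
def incomingStar (Φ : Plane → ℝ) {n : ℕ} (ε : ℝ) (α : Pair n) (t : ℝ)
    (x : Config n) (y : RelConfig α) : ℝ≥0∞ :=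
  incoming Φ ε α t y x

/-- The kernel of `𝒫^ε_{αα'}(t)`. -/
def swapping (Φ : Plane → ℝ) {n : ℕ} (ε : ℝ) (α α' : Pair n) (t : ℝ)
    (y : RelConfig α) (y' : RelConfig α') : ℝ≥0∞ :=
  ENNReal.ofReal (phi Φ y.1 * heat t (S ε α y - S ε α' y') * phi Φ y'.1)

/-- The kernel of the Laplace integral `∫₀^∞ e^{-t} 𝒫^ε_{αα'}(t) dt`. -/
def swappingLaplace (Φ : Plane → ℝ) {n : ℕ} (ε : ℝ) (α α' : Pair n)
    (y : RelConfig α) (y' : RelConfig α') : ℝ≥0∞ :=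
  ∫⁻ t in Set.Ioi (0 : ℝ), ENNReal.ofReal (Real.exp (-t)) * swapping Φ ε α α' t y y'

/-- The kernel of `φ p_ε(2τ) φ` on `L²(ℝ²)`, where `p_ε(τ, y) = p(τ, ε y)`. -/
def pairKernel (Φ : Plane → ℝ) (ε τ : ℝ) (y y' : Plane) : ℝ≥0∞ :=
  ENNReal.ofReal (phi Φ y * hk (2 * τ) (ε • (y - y')) * phi Φ y')

/-- `pairPow Φ ε m t` is the kernel of the time-ordered product of `m + 1` factors
`∫_{τ_1 + ⋯ + τ_{m+1} = t} ∏_k (φ p_ε(2 τ_k) φ)`, as an iterated convolution in time. -/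
def pairPow (Φ : Plane → ℝ) (ε : ℝ) : ℕ → ℝ → Plane → Plane → ℝ≥0∞
  | 0 => fun t y y' => pairKernel Φ ε t y y'
  | m + 1 => fun t y y' =>
      ∫⁻ s in Set.Ioo 0 t, ∫⁻ z : Plane, pairKernel Φ ε s y z * pairPow Φ ε m (t - s) z y'

/-- The bounded operator `J` on `L²(ℝ²)` is
`j^ε(t) = ∑_{ℓ ≥ 1} β_ε^{ℓ+1} ∫_{τ_1 + ⋯ + τ_ℓ = t} ∏_{k ≤ ℓ} (φ p_ε(2 τ_k) φ)`:
every time-ordered product is a bounded operator, and the series converges to `J` in operator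
norm. The summation index here is `m = ℓ - 1`. -/
def IsJ (Φ : Plane → ℝ) (θ ε t : ℝ)
    (J : Lp ℂ 2 (volume : Measure Plane) →L[ℂ] Lp ℂ 2 (volume : Measure Plane)) : Prop :=
  ∃ A : ℕ → (Lp ℂ 2 (volume : Measure Plane) →L[ℂ] Lp ℂ 2 (volume : Measure Plane)),
    (∀ m, HasKernel (pairPow Φ ε m t) (A m)) ∧
      HasSum (fun m => ((beta Φ θ ε ^ (m + 2) : ℝ) : ℂ) • A m) J

end

end DeltaBose

/-! All kernels are nonnegative, so every norm bound comes from a Schur test in two-weight form: if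
K² ≤ K₁K₂, the integrals of K₁ over the second variable are at most a and those of K₂ over the first
are at most b, then ‖K‖² ≤ ab (`exists_operator_of_schur`). What varies is the factorization of K².

Incoming and swapping. With φ² = Φ, put one Φ into a factor and integrate over the configurations of
the pair that carries it. The centre of mass and the free particles integrate to one; what is left
is the relative heat kernel at time 2t, at most 1/(4πt), against the probability density Φ
(`lintegral_heat_S_le`). A factor with Φ therefore costs t⁻¹ and a factor without it costs 1. This
gives t^(-1/2) for the incoming operator and t⁻¹ for the swapping one, uniformly in ε.

Laplace integral for α ≠ α'. The bound t⁻¹ is not integrable at 0, so Cauchy-Schwarz is applied in t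
with the ratio of two regularized gaps |Z_i - Z_j| + t, one for each pair. When integrating over the
configurations of α', the gap of α' depends only on the relative coordinate, while some particle of
α is free and its heat flow turns the inverse gap of α into C/√t (`exists_lintegral_rest_le`). The
remaining time integral of e^(-t) t^(-1/2) (|r| + t) p(2t, r) is bounded uniformly in r
(`lintegral_time_le`), because its singular part is scale invariant.

The series. One factor φ p_ε(2t) φ maps φ to at most φ times min(1/(4πt), M/ε²), where M bounds Φ.
With φ as Schur weight, a time-ordered product is dominated by a scalar convolution power of this
function. Discounting by e^(-lt) gives it a mass I ≤ (log(1/(lε²)) + const)/(4π), whereas 1/β_ε ≥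
(2|log ε| - const)/(4π). The divergent logarithms cancel and leave 1/β - I ≥ log l/(8π) once l is
large. Size biasing (`ofReal_mul_convPow_le`) bounds the (m+1)-fold power at time t by (m+1)
I^m/(4πt), and summing gives e^(lt) (4πt)⁻¹ (1/β - I)⁻². The choice l ≈ max(1/t, const) produces the
factor t⁻¹ |log t|⁻². When t < ε² this l is too large; there l = 1/ε² and the supremum M/ε² are used
instead. -/

namespace DeltaBose

/-! ### The Schur test -/

section Schur

set_option linter.unusedSectionVars false

variable {X Y : Type*} [MeasureSpace X] [MeasureSpace Y] [SFinite (volume : Measure X)]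
  [SFinite (volume : Measure Y)]

/-- Cauchy-Schwarz for the lower Lebesgue integral, in squared form. -/
theorem sq_lintegral_mul_le {Z : Type*} [MeasurableSpace Z] (μ : Measure Z) {f g : Z → ℝ≥0∞}
    (hf : AEMeasurable f μ) (hg : AEMeasurable g μ) :
    (∫⁻ z, f z * g z ∂μ) ^ 2 ≤ (∫⁻ z, f z ^ 2 ∂μ) * ∫⁻ z, g z ^ 2 ∂μ := by
  have h := ENNReal.lintegral_mul_le_Lp_mul_Lq μ Real.HolderConjugate.two_two hf hg
  have h2 : ∀ a : ℝ≥0∞, (a ^ (1 / 2 : ℝ)) ^ 2 = a := fun a => by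
    rw [← ENNReal.rpow_natCast, ← ENNReal.rpow_mul]; norm_num
  calc (∫⁻ z, f z * g z ∂μ) ^ 2
      ≤ ((∫⁻ z, f z ^ (2 : ℝ) ∂μ) ^ (1 / 2 : ℝ) * (∫⁻ z, g z ^ (2 : ℝ) ∂μ) ^ (1 / 2 : ℝ)) ^ 2 := by
        gcongr; exact h
    _ = _ := by rw [mul_pow, h2, h2]; simp

/-- Cauchy-Schwarz for a function dominated by the geometric mean of two others. -/
theorem sq_lintegral_le_of_sq_le {Z : Type*} [MeasurableSpace Z] (μ : Measure Z)
    {k f g : Z → ℝ≥0∞} (hf : AEMeasurable f μ) (hg : AEMeasurable g μ)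
    (h : ∀ᵐ z ∂μ, k z ^ 2 ≤ f z * g z) :
    (∫⁻ z, k z ∂μ) ^ 2 ≤ (∫⁻ z, f z ∂μ) * ∫⁻ z, g z ∂μ := by
  have h2 : ∀ a : ℝ≥0∞, (a ^ (1 / 2 : ℝ)) ^ 2 = a := fun a => by
    rw [← ENNReal.rpow_natCast, ← ENNReal.rpow_mul]; norm_num
  have hk : ∀ᵐ z ∂μ, k z ≤ f z ^ (1 / 2 : ℝ) * g z ^ (1 / 2 : ℝ) := by
    filter_upwards [h] with z hz
    rwa [← ENNReal.pow_le_pow_left_iff two_ne_zero, mul_pow, h2, h2]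
  calc (∫⁻ z, k z ∂μ) ^ 2 ≤ (∫⁻ z, f z ^ (1 / 2 : ℝ) * g z ^ (1 / 2 : ℝ) ∂μ) ^ 2 := by
        gcongr 1; exact lintegral_mono_ae hk
    _ ≤ _ := sq_lintegral_mul_le μ (hf.pow_const _) (hg.pow_const _)
    _ = _ := by simp only [h2]

/-- The Schur test with a weight depending on both variables, for the absolute kernel. -/
theorem lintegral_sq_kernel_le {K K₁ K₂ : X → Y → ℝ≥0∞}
    (hK₁ : Measurable (Function.uncurry K₁)) (hK₂ : Measurable (Function.uncurry K₂))
    (hle : ∀ x y, K x y ^ 2 ≤ K₁ x y * K₂ x y) {a b : ℝ≥0∞}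
    (ha : ∀ x, ∫⁻ y, K₁ x y ≤ a) (hb : ∀ y, ∫⁻ x, K₂ x y ≤ b)
    {f : Y → ℝ≥0∞} (hf : AEMeasurable f) :
    ∫⁻ x, (∫⁻ y, K x y * f y) ^ 2 ≤ a * b * ∫⁻ y, f y ^ 2 := by
  have hm₁ : ∀ x, Measurable (K₁ x) := fun x => hK₁.of_uncurry_left
  have hm₂ : ∀ x, Measurable (K₂ x) := fun x => hK₂.of_uncurry_left
  have hf2 : AEMeasurable (fun p : X × Y => f p.2) (volume.prod volume) :=
    hf.comp_quasiMeasurePreserving Measure.quasiMeasurePreserving_snd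
  calc ∫⁻ x, (∫⁻ y, K x y * f y) ^ 2
      ≤ ∫⁻ x, a * ∫⁻ y, K₂ x y * f y ^ 2 := by
        gcongr with x
        -- Cauchy-Schwarz in y with K f split as √K₁ · √(K₂ f²): the first factor is controlled by
        -- row integrals, the second, after Tonelli, by column integrals.
        refine (sq_lintegral_le_of_sq_le volume (f := K₁ x) (g := fun y => K₂ x y * f y ^ 2)
          (hm₁ x).aemeasurable ((hm₂ x).aemeasurable.mul (hf.pow_const 2))
          (Filter.Eventually.of_forall fun y => ?_)).trans ?_
        · rw [mul_pow, ← mul_assoc]; gcongr; exact hle x y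
        · gcongr; exact ha x
    _ = a * ∫⁻ x, ∫⁻ y, K₂ x y * f y ^ 2 := by
        refine lintegral_const_mul'' _ ?_
        exact (hK₂.aemeasurable.mul (hf2.pow_const 2)).lintegral_prod_right'
    _ = a * ∫⁻ y, ∫⁻ x, K₂ x y * f y ^ 2 := by
        rw [lintegral_lintegral_swap]
        exact hK₂.aemeasurable.mul (hf2.pow_const 2)
    _ = a * ∫⁻ y, (∫⁻ x, K₂ x y) * f y ^ 2 := by
        congr 1; refine lintegral_congr fun y => ?_
        rw [lintegral_mul_const]; exact hK₂.of_uncurry_right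
    _ ≤ a * ∫⁻ y, b * f y ^ 2 := by gcongr with y; exact hb y
    _ = a * b * ∫⁻ y, f y ^ 2 := by
        rw [lintegral_const_mul'' _ (hf.pow_const 2), mul_assoc]

/-- Boundedness on `L²` of the nonnegative kernel `K`, with squared norm at most `C`. -/
def KernelBound (K : X → Y → ℝ≥0∞) (C : ℝ≥0∞) : Prop :=
  ∀ f : Y → ℝ≥0∞, AEMeasurable f → ∫⁻ x, (∫⁻ y, K x y * f y) ^ 2 ≤ C * ∫⁻ y, f y ^ 2

theorem enorm_toReal_mul_le (k : ℝ≥0∞) (z : ℂ) : ‖((k.toReal : ℝ) : ℂ) * z‖ₑ ≤ k * ‖z‖ₑ := by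
  rw [enorm_mul]
  gcongr
  rw [← ofReal_norm, Complex.norm_real, Real.norm_of_nonneg ENNReal.toReal_nonneg]
  exact ENNReal.ofReal_toReal_le

theorem lintegral_enorm_sq (f : Lp ℂ 2 (volume : Measure Y)) :
    ∫⁻ y, ‖f y‖ₑ ^ 2 = ENNReal.ofReal (‖f‖ ^ 2) := by
  rw [Lp.norm_def, ← ENNReal.toReal_pow, ENNReal.ofReal_toReal (by simp [Lp.eLpNorm_ne_top])]
  rw [eLpNorm_eq_lintegral_rpow_enorm_toReal (by simp) (by simp)]
  rw [← ENNReal.rpow_natCast, ← ENNReal.rpow_mul]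
  simp

variable {K : X → Y → ℝ≥0∞}

theorem aestronglyMeasurable_integral_kernel (hK : Measurable (Function.uncurry K))
    (f : Lp ℂ 2 (volume : Measure Y)) :
    AEStronglyMeasurable (fun x => ∫ y, ((K x y).toReal : ℂ) * f y) volume := by
  have : StronglyMeasurable (fun p : X × Y => ((K p.1 p.2).toReal : ℂ) * f p.2) := by
    refine StronglyMeasurable.mul ?_ ((Lp.stronglyMeasurable f).comp_measurable measurable_snd)
    exact (Complex.measurable_ofReal.comp hK.ennreal_toReal).stronglyMeasurable
  exact this.integral_prod_right'.aestronglyMeasurable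

theorem ae_lintegral_kernel_lt_top (hK : Measurable (Function.uncurry K)) {C : ℝ≥0∞} (hC : C ≠ ⊤)
    (hb : KernelBound K C) (f : Lp ℂ 2 (volume : Measure Y)) :
    ∀ᵐ x : X, (∫⁻ y, K x y * ‖f y‖ₑ) < ⊤ := by
  have hm : Measurable fun x => (∫⁻ y, K x y * ‖f y‖ₑ) ^ 2 := by
    refine Measurable.pow_const ?_ 2
    exact (hK.mul (((Lp.stronglyMeasurable f).measurable.enorm).comp
      measurable_snd)).lintegral_prod_right'
  have h := hb (fun y => ‖f y‖ₑ) (Lp.aestronglyMeasurable f).enorm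
  rw [lintegral_enorm_sq] at h
  filter_upwards [ae_lt_top hm (h.trans_lt (ENNReal.mul_lt_top hC.lt_top
    ENNReal.ofReal_lt_top)).ne] with x hx
  by_contra hx'
  rw [not_lt, top_le_iff] at hx'
  simp [hx'] at hx

theorem integrable_kernel_mul (hK : Measurable (Function.uncurry K))
    (f : Lp ℂ 2 (volume : Measure Y)) {x : X} (hx : (∫⁻ y, K x y * ‖f y‖ₑ) < ⊤) :
    Integrable (fun y => ((K x y).toReal : ℂ) * f y) := by
  refine ⟨?_, lt_of_le_of_lt (lintegral_mono fun y => enorm_toReal_mul_le _ _) hx⟩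
  exact ((Complex.measurable_ofReal.comp
    (hK.of_uncurry_left (x := x)).ennreal_toReal).stronglyMeasurable.mul
    (Lp.stronglyMeasurable f)).aestronglyMeasurable

theorem lintegral_enorm_integral_kernel_sq_le {C : ℝ≥0∞}
    (hb : KernelBound K C) (f : Lp ℂ 2 (volume : Measure Y)) :
    ∫⁻ x, ‖∫ y, ((K x y).toReal : ℂ) * f y‖ₑ ^ 2 ≤ C * ENNReal.ofReal (‖f‖ ^ 2) := by
  rw [← lintegral_enorm_sq]
  refine le_trans (lintegral_mono fun x => ?_)
    (hb (fun y => ‖f y‖ₑ) (Lp.aestronglyMeasurable f).enorm)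
  gcongr
  exact (enorm_integral_le_lintegral_enorm _).trans
    (lintegral_mono fun y => enorm_toReal_mul_le _ _)

theorem memLp_integral_kernel (hK : Measurable (Function.uncurry K)) {C : ℝ≥0∞} (hC : C ≠ ⊤)
    (hb : KernelBound K C) (f : Lp ℂ 2 (volume : Measure Y)) :
    MemLp (fun x => ∫ y, ((K x y).toReal : ℂ) * f y) 2 volume := by
  refine ⟨aestronglyMeasurable_integral_kernel hK f, ?_⟩
  rw [eLpNorm_lt_top_iff_lintegral_rpow_enorm_lt_top (by simp) (by simp)]
  refine lt_of_le_of_lt (le_of_eq ?_) ((lintegral_enorm_integral_kernel_sq_le hb f).trans_lt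
    (ENNReal.mul_lt_top hC.lt_top ENNReal.ofReal_lt_top))
  simp

/-- A measurable kernel bounded on `L²` defines a bounded operator. -/
theorem KernelBound.exists_operator (hK : Measurable (Function.uncurry K)) {c : ℝ} (hc : 0 ≤ c)
    (hb : KernelBound K (ENNReal.ofReal (c ^ 2))) :
    ∃ T : Lp ℂ 2 (volume : Measure Y) →L[ℂ] Lp ℂ 2 (volume : Measure X),
      HasKernel K T ∧ ‖T‖ ≤ c := by
  have hmem := memLp_integral_kernel hK ENNReal.ofReal_ne_top hb
  have hfin := ae_lintegral_kernel_lt_top hK ENNReal.ofReal_ne_top hb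
  let L : Lp ℂ 2 (volume : Measure Y) →ₗ[ℂ] Lp ℂ 2 (volume : Measure X) :=
    { toFun := fun f => (hmem f).toLp
      map_add' := fun f g => by
        rw [← MemLp.toLp_add]
        refine MemLp.toLp_congr _ _ ?_
        -- Bochner integrals add only where both converge absolutely, which is almost everywhere by
        -- `hfin`.
        filter_upwards [hfin f, hfin g] with x hf hg
        rw [Pi.add_apply, ← integral_add (integrable_kernel_mul hK f hf)
          (integrable_kernel_mul hK g hg)]
        refine integral_congr_ae ?_
        filter_upwards [Lp.coeFn_add f g] with y hy
        rw [hy, Pi.add_apply, mul_add]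
      map_smul' := fun a f => by
        rw [RingHom.id_apply, ← MemLp.toLp_const_smul]
        refine MemLp.toLp_congr _ _ (Filter.Eventually.of_forall fun x => ?_)
        rw [Pi.smul_apply, ← integral_smul]
        refine integral_congr_ae ?_
        filter_upwards [Lp.coeFn_smul a f] with y hy
        rw [hy, Pi.smul_apply, smul_eq_mul, smul_eq_mul, mul_left_comm] }
  have hL : ∀ f, L f =ᵐ[volume] fun x => ∫ y, ((K x y).toReal : ℂ) * f y :=
    fun f => (hmem f).coeFn_toLp
  have hbound : ∀ f, ‖L f‖ ≤ c * ‖f‖ := fun f => by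
    have h1 : ENNReal.ofReal (‖L f‖ ^ 2) ≤ ENNReal.ofReal ((c * ‖f‖) ^ 2) := by
      rw [← lintegral_enorm_sq, mul_pow, ENNReal.ofReal_mul (by positivity)]
      refine le_trans (le_of_eq (lintegral_congr_ae ?_))
        (lintegral_enorm_integral_kernel_sq_le hb f)
      filter_upwards [hL f] with x hx
      rw [hx]
    rw [ENNReal.ofReal_le_ofReal_iff (by positivity)] at h1
    exact (sq_le_sq₀ (norm_nonneg _) (by positivity)).1 h1
  refine ⟨L.mkContinuous c hbound, fun f => ?_, L.mkContinuous_norm_le hc hbound⟩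
  filter_upwards [hfin f, hL f] with x h1 h2
  exact ⟨h1, h2⟩

/-- Operators with transposed kernels are adjoint to each other. -/
theorem HasKernel.eq_adjoint (hK : Measurable (Function.uncurry K)) {C : ℝ≥0∞} (hC : C ≠ ⊤)
    (hb : KernelBound K C)
    {T : Lp ℂ 2 (volume : Measure Y) →L[ℂ] Lp ℂ 2 (volume : Measure X)}
    {T' : Lp ℂ 2 (volume : Measure X) →L[ℂ] Lp ℂ 2 (volume : Measure Y)}
    (hT : HasKernel K T) (hT' : HasKernel (fun y x => K x y) T') :
    T' = ContinuousLinearMap.adjoint T := by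
  rw [ContinuousLinearMap.eq_adjoint_iff]
  intro g f
  rw [L2.inner_def, L2.inner_def]
  let F : X → Y → ℂ := fun x y => (starRingEnd ℂ) (g x) * (((K x y).toReal : ℂ) * f y)
  have hF : Integrable (Function.uncurry F) (volume.prod volume) := by
    have hgm := (Lp.stronglyMeasurable g).measurable
    have hfm := (Lp.stronglyMeasurable f).measurable
    refine ⟨?_, ?_⟩
    · refine Measurable.aestronglyMeasurable ?_
      refine (Complex.continuous_conj.measurable.comp (hgm.comp measurable_fst)).mul ?_
      exact (Complex.measurable_ofReal.comp hK.ennreal_toReal).mul (hfm.comp measurable_snd)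
    · have hm : Measurable fun x => ∫⁻ y, K x y * ‖f y‖ₑ :=
        (hK.mul (hfm.enorm.comp measurable_snd)).lintegral_prod_right'
      have h1 : ∫⁻ p, ‖Function.uncurry F p‖ₑ ∂(volume.prod volume)
          ≤ ∫⁻ x, ‖g x‖ₑ * ∫⁻ y, K x y * ‖f y‖ₑ := by
        refine (lintegral_prod_le _).trans (lintegral_mono fun x => ?_)
        rw [← lintegral_const_mul]
        · refine lintegral_mono fun y => ?_
          simp only [F, Function.uncurry_apply_pair]
          rw [enorm_mul, RCLike.enorm_conj]
          gcongr
          exact enorm_toReal_mul_le _ _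
        · exact (hK.of_uncurry_left (x := x)).mul hfm.enorm
      have h2 := sq_lintegral_mul_le (volume : Measure X) hgm.enorm.aemeasurable hm.aemeasurable
      -- Absolute convergence of the double integral, needed for Fubini: by Cauchy-Schwarz its
      -- square is at most C ‖g‖² ‖f‖².
      have h3 : (∫⁻ x, ‖g x‖ₑ * ∫⁻ y, K x y * ‖f y‖ₑ) ^ 2 < ⊤ := by
        refine h2.trans_lt (ENNReal.mul_lt_top ?_ ?_)
        · rw [lintegral_enorm_sq]; exact ENNReal.ofReal_lt_top
        · refine (hb _ hfm.enorm.aemeasurable).trans_lt (ENNReal.mul_lt_top hC.lt_top ?_)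
          rw [lintegral_enorm_sq]; exact ENNReal.ofReal_lt_top
      refine h1.trans_lt ?_
      by_contra h4
      rw [not_lt, top_le_iff] at h4
      simp [h4] at h3
  have e1 : ∫ y, inner ℂ (T' g y) (f y) = ∫ y, ∫ x, F x y := by
    refine integral_congr_ae ?_
    filter_upwards [hT' g] with y hy
    rw [hy.2, RCLike.inner_apply, ← integral_conj, ← integral_const_mul]
    refine integral_congr_ae (Filter.Eventually.of_forall fun x => ?_)
    simp only [F, map_mul, Complex.conj_ofReal]
    ring
  have e2 : ∫ x, inner ℂ (g x) (T f x) = ∫ x, ∫ y, F x y := by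
    refine integral_congr_ae ?_
    filter_upwards [hT f] with x hx
    rw [hx.2, RCLike.inner_apply, mul_comm, ← integral_const_mul]
  rw [e1, e2, integral_integral_swap hF]

/-- The Schur test with a weight depending on both variables. -/
theorem exists_operator_of_schur {K₁ K₂ : X → Y → ℝ≥0∞} (hK : Measurable (Function.uncurry K))
    (hK₁ : Measurable (Function.uncurry K₁)) (hK₂ : Measurable (Function.uncurry K₂))
    (hle : ∀ x y, K x y ^ 2 ≤ K₁ x y * K₂ x y) {a b : ℝ} (ha0 : 0 ≤ a) (hb0 : 0 ≤ b)
    (ha : ∀ x, ∫⁻ y, K₁ x y ≤ ENNReal.ofReal a) (hb : ∀ y, ∫⁻ x, K₂ x y ≤ ENNReal.ofReal b) :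
    ∃ T : Lp ℂ 2 (volume : Measure Y) →L[ℂ] Lp ℂ 2 (volume : Measure X),
      HasKernel K T ∧ ‖T‖ ≤ √(a * b) := by
  refine KernelBound.exists_operator hK (Real.sqrt_nonneg _) fun f hf => ?_
  rw [Real.sq_sqrt (by positivity), ENNReal.ofReal_mul ha0]
  exact lintegral_sq_kernel_le hK₁ hK₂ hle ha hb hf

/-- The Schur test for an operator together with its transpose. -/
theorem exists_operator_transpose_of_schur {K₁ K₂ : X → Y → ℝ≥0∞}
    (hK : Measurable (Function.uncurry K))
    (hK₁ : Measurable (Function.uncurry K₁)) (hK₂ : Measurable (Function.uncurry K₂))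
    (hle : ∀ x y, K x y ^ 2 ≤ K₁ x y * K₂ x y) {a b : ℝ} (ha0 : 0 ≤ a) (hb0 : 0 ≤ b)
    (ha : ∀ x, ∫⁻ y, K₁ x y ≤ ENNReal.ofReal a) (hb : ∀ y, ∫⁻ x, K₂ x y ≤ ENNReal.ofReal b) :
    ∃ (T : Lp ℂ 2 (volume : Measure Y) →L[ℂ] Lp ℂ 2 (volume : Measure X))
      (T' : Lp ℂ 2 (volume : Measure X) →L[ℂ] Lp ℂ 2 (volume : Measure Y)),
      HasKernel K T ∧ HasKernel (fun y x => K x y) T' ∧ ‖T‖ = ‖T'‖ ∧ ‖T‖ ≤ √(a * b) := by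
  obtain ⟨T, hT, hTn⟩ := exists_operator_of_schur hK hK₁ hK₂ hle ha0 hb0 ha hb
  obtain ⟨T', hT', -⟩ := exists_operator_of_schur (K := fun y x => K x y)
    (K₁ := fun y x => K₂ x y) (K₂ := fun y x => K₁ x y)
    (hK.comp measurable_swap) (hK₂.comp measurable_swap) (hK₁.comp measurable_swap)
    (fun y x => by rw [mul_comm]; exact hle x y) hb0 ha0 hb ha
  refine ⟨T, T', hT, hT', ?_, hTn⟩
  have := hT.eq_adjoint hK (C := ENNReal.ofReal a * ENNReal.ofReal b)
    (ENNReal.mul_ne_top ENNReal.ofReal_ne_top ENNReal.ofReal_ne_top)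
    (fun f hf => lintegral_sq_kernel_le hK₁ hK₂ hle ha hb hf) hT'
  rw [this]
  exact (ContinuousLinearMap.adjoint.norm_map T).symm

end Schur

/-! ### Heat kernels on the plane -/

theorem hk_nonneg {t : ℝ} (ht : 0 ≤ t) (x : Plane) : 0 ≤ hk t x := by
  unfold hk; positivity

theorem measurable_hk : Measurable fun p : ℝ × Plane => hk p.1 p.2 := by
  unfold hk; fun_prop

theorem hk_le {t : ℝ} (ht : 0 < t) (x : Plane) : hk t x ≤ 1 / (2 * Real.pi * t) := by
  unfold hk
  gcongr
  rw [Real.exp_le_one_iff, neg_div]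
  exact neg_nonpos.2 (by positivity)

theorem hk_neg (t : ℝ) (x : Plane) : hk t (-x) = hk t x := by simp [hk]

/-- The heat kernel has total mass one. -/
theorem lintegral_hk {t : ℝ} (ht : 0 < t) : ∫⁻ x, ENNReal.ofReal (hk t x) = 1 := by
  have h : ∀ x : Plane, hk t x = Real.exp (-(1 / (2 * t)) * ‖x‖ ^ 2) / (2 * Real.pi * t) :=
    fun x => by unfold hk; congr 2; ring
  have hi := GaussianFourier.integral_rexp_neg_mul_sq_norm (V := Plane)
    (b := 1 / (2 * t)) (by positivity)
  have hint : ∫ x : Plane, hk t x = 1 := by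
    simp_rw [h]
    rw [integral_div, hi]
    simp
    field_simp
  rw [← ofReal_integral_eq_lintegral_ofReal, hint, ENNReal.ofReal_one]
  · by_contra hn
    rw [integral_undef hn] at hint
    exact zero_ne_one hint
  · exact Filter.Eventually.of_forall fun x => hk_nonneg ht.le x

theorem lintegral_hk_sub {t : ℝ} (ht : 0 < t) (a : Plane) :
    ∫⁻ x, ENNReal.ofReal (hk t (a - x)) = 1 := by
  rw [lintegral_sub_left_eq_self (fun x => ENNReal.ofReal (hk t x)) a, lintegral_hk ht]

/-- A product of two heat kernels in the center-of-mass and relative coordinates. -/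
theorem hk_mul_hk {t : ℝ} (ht : 0 < t) (a b : Plane) :
    hk t a * hk t b = hk (t / 2) ((1 / 2 : ℝ) • (a + b)) * hk (2 * t) (a - b) := by
  unfold hk
  rw [div_mul_div_comm, div_mul_div_comm, ← Real.exp_add, ← Real.exp_add]
  have h := parallelogram_law_with_norm ℝ a b
  congr 1
  · congr 1
    rw [norm_smul, mul_pow]
    simp only [one_div, norm_inv, Real.norm_ofNat]
    field_simp
    linarith
  · ring

theorem measurable_ofReal_hk (t : ℝ) : Measurable fun x : Plane => ENNReal.ofReal (hk t x) :=
  (measurable_hk.comp (measurable_const.prodMk measurable_id)).ennreal_ofReal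

section Pi

variable {ι : Type*} [Fintype ι]

theorem lintegral_prod_hk {t : ℝ} (ht : 0 < t) (a : ι → Plane) :
    ∫⁻ z : ι → Plane, ∏ i, ENNReal.ofReal (hk t (a i - z i)) = 1 := by
  have hi : ∀ i, Integrable (fun x : Plane => hk t (a i - x)) := fun i => by
    refine ⟨(measurable_hk.comp (measurable_const.prodMk
      (measurable_const.sub measurable_id))).aestronglyMeasurable, ?_⟩
    rw [hasFiniteIntegral_iff_ofReal (Filter.Eventually.of_forall fun x => hk_nonneg ht.le _),
      lintegral_hk_sub ht]
    exact ENNReal.one_lt_top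
  have h1 : ∀ i, ∫ x : Plane, hk t (a i - x) = 1 := fun i => by
    rw [integral_eq_lintegral_of_nonneg_ae (Filter.Eventually.of_forall fun x => hk_nonneg ht.le _)
      (hi i).1, lintegral_hk_sub ht, ENNReal.toReal_one]
  have h2 := integral_fintype_prod_volume_eq_prod (fun i (x : Plane) => hk t (a i - x))
  simp only [h1, Finset.prod_const_one] at h2
  calc ∫⁻ z : ι → Plane, ∏ i, ENNReal.ofReal (hk t (a i - z i))
      = ∫⁻ z : ι → Plane, ENNReal.ofReal (∏ i, hk t (a i - z i)) := by
        refine lintegral_congr fun z => ?_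
        rw [ENNReal.ofReal_prod_of_nonneg fun i _ => hk_nonneg ht.le _]
    _ = ENNReal.ofReal (∫ z : ι → Plane, ∏ i, hk t (a i - z i)) := by
        rw [ofReal_integral_eq_lintegral_ofReal]
        · exact Integrable.fintype_prod hi
        · exact Filter.Eventually.of_forall fun z =>
            Finset.prod_nonneg fun i _ => hk_nonneg ht.le _
    _ = 1 := by rw [h2, ENNReal.ofReal_one]

theorem measurable_prod_hk (t : ℝ) (a : ι → Plane) :
    Measurable fun z : ι → Plane => ∏ i, ENNReal.ofReal (hk t (a i - z i)) :=
  Finset.measurable_prod _ fun i _ =>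
    (measurable_ofReal_hk t).comp (measurable_const.sub (measurable_pi_apply i))

/-- Integrating out one coordinate first. -/
theorem lintegral_prod_hk_mul_le [DecidableEq ι] {t : ℝ} (ht : 0 < t) (a : ι → Plane) (k : ι)
    {H : (ι → Plane) → ℝ≥0∞} (hH : Measurable H) {C : ℝ≥0∞}
    (hC : ∀ z : ι → Plane,
      ∫⁻ x, ENNReal.ofReal (hk t (a k - x)) * H (Function.update z k x) ≤ C) :
    ∫⁻ z : ι → Plane, (∏ i, ENNReal.ofReal (hk t (a i - z i))) * H z ≤ C := by
  have hsplit : ∀ (z : ι → Plane) (x : Plane),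
      ∏ i, ENNReal.ofReal (hk t (a i - Function.update z k x i)) =
        ENNReal.ofReal (hk t (a k - x)) *
          ∏ i ∈ Finset.univ.erase k, ENNReal.ofReal (hk t (a i - z i)) := fun z x => by
    rw [← Finset.mul_prod_erase _ _ (Finset.mem_univ k), Function.update_self]
    congr 1
    refine Finset.prod_congr rfl fun i hi => ?_
    rw [Function.update_of_ne (Finset.ne_of_mem_erase hi)]
  have hm := measurable_prod_hk (ι := ι) t a
  have hmk : Measurable fun x : Plane => ENNReal.ofReal (hk t (a k - x)) :=
    (measurable_ofReal_hk t).comp (measurable_const.sub measurable_id)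
  -- An arbitrary base point: a marginal over all coordinates does not depend on it.
  let z₀ : ι → Plane := 0
  -- The right side keeps the full product, whose k-th factor has mass one, so that both sides are
  -- marginals in k of functions of the whole configuration and can be compared by monotonicity.
  have key : ∀ z : ι → Plane,
      ∫⁻ x, (∏ i, ENNReal.ofReal (hk t (a i - Function.update z k x i))) *
        H (Function.update z k x) ≤
      ∫⁻ x, C * ∏ i, ENNReal.ofReal (hk t (a i - Function.update z k x i)) := fun z => by
    have hmu : Measurable fun x : Plane => H (Function.update z k x) :=
      hH.comp (measurable_update z)
    simp_rw [hsplit]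
    calc _ = (∏ i ∈ Finset.univ.erase k, ENNReal.ofReal (hk t (a i - z i))) *
          ∫⁻ x, ENNReal.ofReal (hk t (a k - x)) * H (Function.update z k x) := by
          rw [← lintegral_const_mul _ (by exact hmk.mul hmu)]
          refine lintegral_congr fun x => by ring
      _ ≤ (∏ i ∈ Finset.univ.erase k, ENNReal.ofReal (hk t (a i - z i))) * C := by
          gcongr; exact hC z
      _ = _ := by
          rw [lintegral_const_mul _ (hmk.mul_const _), lintegral_mul_const _ hmk,
            lintegral_hk_sub ht, one_mul, mul_comm]
  calc ∫⁻ z : ι → Plane, (∏ i, ENNReal.ofReal (hk t (a i - z i))) * H z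
      ≤ ∫⁻ z : ι → Plane, C * ∏ i, ENNReal.ofReal (hk t (a i - z i)) := by
        rw [volume_pi, lintegral_eq_lmarginal_univ z₀, lintegral_eq_lmarginal_univ z₀,
          lmarginal_erase' _ (by exact hm.mul hH) (Finset.mem_univ k),
          lmarginal_erase' _ (by exact hm.const_mul C) (Finset.mem_univ k)]
        exact lmarginal_mono (fun z => key z) z₀
    _ = C := by rw [lintegral_const_mul _ hm, lintegral_prod_hk ht, mul_one]

end Pi

/-- The inverse norm is integrable on the unit disc. -/
theorem integrableOn_ball_inv_norm (r : ℝ) :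
    IntegrableOn (fun x : Plane => ‖x‖⁻¹) (Metric.ball 0 r) := by
  refine integrableOn_ball_of_norm_le_rpow (C := 1) (α := 1) (by simp) (by simp)
    (Filter.Eventually.of_forall fun x => ?_) (by fun_prop)
  rw [Real.rpow_neg_one, one_mul, norm_inv, norm_norm]

/-- Scaling: in dimension two the area contributes s² and the inverse norm s⁻¹. -/
theorem setIntegral_ball_inv_norm {s : ℝ} (hs : 0 < s) :
    ∫ x in Metric.ball (0 : Plane) s, ‖x‖⁻¹ =
      s * ∫ x in Metric.ball (0 : Plane) 1, ‖x‖⁻¹ := by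
  have h := Measure.setIntegral_comp_smul_of_pos volume (fun x : Plane => ‖x‖⁻¹)
    (Metric.ball (0 : Plane) 1) hs
  rw [smul_ball hs.ne', smul_zero, Real.norm_of_nonneg hs.le, mul_one] at h
  simp only [norm_smul, Real.norm_of_nonneg hs.le, mul_inv, integral_const_mul,
    finrank_euclideanSpace, Fintype.card_fin, smul_eq_mul] at h
  field_simp at h ⊢
  linarith

/-- Heat flow regularizes the inverse norm at scale `√t`. -/
theorem exists_lintegral_hk_mul_inv_le : ∃ C : ℝ, 0 < C ∧ ∀ t : ℝ, 0 < t → ∀ w : Plane,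
    ∫⁻ z, ENNReal.ofReal (hk t z) * ENNReal.ofReal (‖z - w‖ + t)⁻¹ ≤
      ENNReal.ofReal (C / √t) := by
  set B := ∫ x in Metric.ball (0 : Plane) 1, ‖x‖⁻¹ with hB
  have hB0 : 0 ≤ B := integral_nonneg fun x => by positivity
  refine ⟨1 + B, by positivity, fun t ht w => ?_⟩
  have hst : 0 < √t := Real.sqrt_pos.2 ht
  -- Split at distance √t from w. Outside, the inverse distance is at most 1/√t and the heat kernel
  -- has mass one; inside, the heat kernel is at most 1/t and the inverse norm integrates to a
  -- multiple of √t.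
  have hpt : ∀ᵐ z : Plane, ENNReal.ofReal (hk t z) * ENNReal.ofReal (‖z - w‖ + t)⁻¹ ≤
      ENNReal.ofReal (hk t z) * ENNReal.ofReal (√t)⁻¹ +
      ENNReal.ofReal t⁻¹ *
        (Metric.ball (0 : Plane) √t).indicator (fun x => ENNReal.ofReal ‖x‖⁻¹) (z - w) := by
    -- The point z = w must be discarded, since the inverse of 0 is 0 there while the left side is
    -- positive.
    filter_upwards [compl_mem_ae_iff.2 (measure_singleton w)] with z hzw
    by_cases hz : z - w ∈ Metric.ball (0 : Plane) √t
    · rw [Set.indicator_of_mem hz]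
      refine le_add_left ?_
      have h0 : 0 < ‖z - w‖ := norm_pos_iff.2 (sub_ne_zero.2 hzw)
      gcongr
      · refine (hk_le ht z).trans ?_
        rw [one_div]
        gcongr
        have := Real.pi_gt_three
        nlinarith
      · linarith
    · rw [mem_ball_zero_iff, not_lt] at hz
      refine le_add_right ?_
      gcongr
      linarith
  refine (lintegral_mono_ae hpt).trans ?_
  rw [lintegral_add_left ((measurable_ofReal_hk t).mul_const _),
    lintegral_mul_const _ (measurable_ofReal_hk t), lintegral_hk ht, one_mul,
    lintegral_const_mul']
  rotate_left
  · exact ENNReal.ofReal_ne_top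
  rw [lintegral_sub_right_eq_self (fun z => (Metric.ball (0 : Plane) √t).indicator
    (fun x => ENNReal.ofReal ‖x‖⁻¹) z) w, lintegral_indicator Metric.isOpen_ball.measurableSet,
    ← ofReal_integral_eq_lintegral_ofReal (integrableOn_ball_inv_norm _)
      (Filter.Eventually.of_forall fun x => by positivity), setIntegral_ball_inv_norm hst,
    ← ENNReal.ofReal_mul (by positivity), ← ENNReal.ofReal_add (by positivity) (by positivity)]
  refine ENNReal.ofReal_le_ofReal (le_of_eq ?_)
  rw [← hB]
  nth_rewrite 2 [← Real.mul_self_sqrt ht.le]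
  field_simp

/-! ### Incoming and swapping operators -/

section Swapping

variable {n : ℕ} {Φ : Plane → ℝ}

/-- Splitting a product over all labels into the pair and the rest. -/
theorem prod_eq_pair_mul_rest {M : Type*} [CommMonoid M] (α : Pair n) (f : Fin n → M) :
    ∏ k, f k = f α.1.1 * f α.1.2 * ∏ k : Rest α, f k := by
  have h : α.1.2 ∈ Finset.univ.erase α.1.1 := by simp [α.2.ne']
  rw [← Finset.mul_prod_erase _ _ (Finset.mem_univ α.1.1), ← Finset.mul_prod_erase _ _ h, mul_assoc]
  congr 2
  refine (Finset.prod_subtype _ (fun k => ?_) f)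
  simp [and_comm]

theorem S_fst (ε : ℝ) (α : Pair n) (y : RelConfig α) :
    S ε α y α.1.1 = y.2.1 + (ε / 2) • y.1 := by simp [S]

theorem S_snd (ε : ℝ) (α : Pair n) (y : RelConfig α) :
    S ε α y α.1.2 = y.2.1 - (ε / 2) • y.1 := by simp [S, α.2.ne']

theorem S_rest (ε : ℝ) (α : Pair n) (y : RelConfig α) (k : Rest α) :
    S ε α y k = y.2.2 k := by simp [S, k.2.1, k.2.2]

theorem measurable_S (ε : ℝ) (α : Pair n) : Measurable (S ε α) := by
  refine measurable_pi_iff.2 fun k => ?_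
  unfold S
  split_ifs <;> fun_prop

theorem heat_nonneg {t : ℝ} (ht : 0 ≤ t) (x : Config n) : 0 ≤ heat t x :=
  Finset.prod_nonneg fun _ _ => hk_nonneg ht _

theorem heat_neg (t : ℝ) (x : Config n) : heat t (-x) = heat t x := by
  simp [heat, hk_neg]

theorem ofReal_heat {t : ℝ} (ht : 0 ≤ t) (x : Config n) :
    ENNReal.ofReal (heat t x) = ∏ i, ENNReal.ofReal (hk t (x i)) :=
  ENNReal.ofReal_prod_of_nonneg fun _ _ => hk_nonneg ht _

theorem measurable_heat : Measurable fun p : ℝ × Config n => heat p.1 p.2 := by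
  have h : ∀ i, Measurable fun p : ℝ × Config n => hk p.1 (p.2 i) := fun i =>
    measurable_hk.comp (f := fun p : ℝ × Config n => (p.1, p.2 i)) (by fun_prop)
  exact Finset.measurable_fun_prod Finset.univ fun i _ => h i

theorem lintegral_heat_sub {t : ℝ} (ht : 0 < t) (x : Config n) :
    ∫⁻ z, ENNReal.ofReal (heat t (x - z)) = 1 := by
  simp_rw [ofReal_heat ht.le]
  exact lintegral_prod_hk ht x

/-- Integrating the heat kernel over the range of `S^ε_α`, against a factor `A` of the relative
coordinate of the pair and a factor `B` which is controlled by integrating out the rest. -/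
theorem lintegral_heat_S_mul_le {w : Plane → ℝ≥0∞} (hw : ∀ v, w v ≠ ⊤) (ε : ℝ) (α : Pair n)
    {t : ℝ} (ht : 0 < t) (X : Config n) {A : Plane → ℝ≥0∞} (hA : ∀ r, A r ≠ ⊤)
    {B : Config n → ℝ≥0∞} {C : ℝ≥0∞}
    (hC : ∀ v m : Plane, ∫⁻ z : Rest α → Plane,
      (∏ k : Rest α, ENNReal.ofReal (hk t (X k - z k))) * B (X - S ε α (v, m, z)) ≤ C) :
    ∫⁻ y : RelConfig α, w y.1 * ENNReal.ofReal (heat t (X - S ε α y)) *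
        (A (X α.1.1 - X α.1.2 - ε • y.1) * B (X - S ε α y)) ≤
      ∫⁻ v, w v * (C * (A (X α.1.1 - X α.1.2 - ε • v) *
        ENNReal.ofReal (hk (2 * t) (X α.1.1 - X α.1.2 - ε • v)))) := by
  rw [show (volume : Measure (RelConfig α)) =
    (volume : Measure Plane).prod (volume : Measure (Plane × (Rest α → Plane))) from rfl]
  -- This direction of Tonelli needs no measurability, and a finite constant can be pulled out
  -- without it; hence only finiteness is asked of `w` and `A`, and nothing of `B`.
  refine (lintegral_prod_le _).trans (lintegral_mono fun v => ?_)
  rw [show (volume : Measure (Plane × (Rest α → Plane))) =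
    (volume : Measure Plane).prod (volume : Measure (Rest α → Plane)) from rfl]
  refine (lintegral_prod_le _).trans ?_
  set r := X α.1.1 - X α.1.2 - ε • v with hr
  set c : Plane := (1 / 2 : ℝ) • (X α.1.1 + X α.1.2) with hc
  -- The two heat kernels of the pair separate into a centre-of-mass factor, which m will integrate
  -- to one, and a relative factor depending only on v. As v is integrated against `w` and not
  -- rescaled, no power of ε appears.
  have hheat : ∀ (m : Plane) (z : Rest α → Plane),
      ENNReal.ofReal (heat t (X - S ε α (v, m, z))) =
        ENNReal.ofReal (hk (t / 2) (c - m)) * ENNReal.ofReal (hk (2 * t) r) *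
          ∏ k : Rest α, ENNReal.ofReal (hk t (X k - z k)) := fun m z => by
    rw [ofReal_heat ht.le, prod_eq_pair_mul_rest α, ← ENNReal.ofReal_mul (hk_nonneg ht.le _),
      hk_mul_hk ht, ENNReal.ofReal_mul (hk_nonneg (by positivity) _)]
    simp only [Pi.sub_apply, S_fst, S_snd, S_rest]
    congr 4
    · rw [hc]; module
    · rw [hr]; module
  calc ∫⁻ m, ∫⁻ z : Rest α → Plane, w v * ENNReal.ofReal (heat t (X - S ε α (v, m, z))) *
        (A r * B (X - S ε α (v, m, z)))
      ≤ ∫⁻ m, (w v * (C * (A r * ENNReal.ofReal (hk (2 * t) r)))) *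
          ENNReal.ofReal (hk (t / 2) (c - m)) := by
        refine lintegral_mono fun m => ?_
        have hfin : w v * A r * ENNReal.ofReal (hk (t / 2) (c - m)) *
            ENNReal.ofReal (hk (2 * t) r) ≠ ⊤ :=
          ENNReal.mul_ne_top (ENNReal.mul_ne_top (ENNReal.mul_ne_top (hw v) (hA r))
            ENNReal.ofReal_ne_top) ENNReal.ofReal_ne_top
        calc _ = ∫⁻ z : Rest α → Plane, w v * A r * ENNReal.ofReal (hk (t / 2) (c - m)) *
              ENNReal.ofReal (hk (2 * t) r) *
              ((∏ k : Rest α, ENNReal.ofReal (hk t (X k - z k))) *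
                B (X - S ε α (v, m, z))) := by
              refine lintegral_congr fun z => ?_
              rw [hheat]; ring
          _ ≤ w v * A r * ENNReal.ofReal (hk (t / 2) (c - m)) *
              ENNReal.ofReal (hk (2 * t) r) * C := by
              rw [lintegral_const_mul' _ _ hfin]
              gcongr
              exact hC v m
          _ = _ := by ring
    _ = w v * (C * (A r * ENNReal.ofReal (hk (2 * t) r))) := by
        rw [lintegral_const_mul, lintegral_hk_sub (by positivity), mul_one]
        exact (measurable_ofReal_hk _).comp (measurable_const.sub measurable_id)

/-- Marginal bound: the heat kernel integrated against `w` over the range of `S^ε_α`. -/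
theorem lintegral_heat_S_le {w : Plane → ℝ≥0∞} (hw : ∀ v, w v ≠ ⊤) (hwm : Measurable w)
    (ε : ℝ) (α : Pair n) {t : ℝ} (ht : 0 < t) (X : Config n) :
    ∫⁻ y : RelConfig α, w y.1 * ENNReal.ofReal (heat t (X - S ε α y)) ≤
      ENNReal.ofReal t⁻¹ * ∫⁻ v, w v := by
  have h := lintegral_heat_S_mul_le hw ε α ht X (A := fun _ => 1) (B := fun _ => 1) (C := 1)
    (fun _ => ENNReal.one_ne_top) (fun v m => by simp [lintegral_prod_hk ht])
  simp only [mul_one, one_mul] at h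
  refine h.trans ?_
  rw [← lintegral_const_mul _ hwm]
  refine lintegral_mono fun v => ?_
  rw [mul_comm]
  gcongr
  -- The relative kernel runs at time 2t, so its maximum is 1/(4πt) ≤ 1/t.
  refine (hk_le (by positivity) _).trans ?_
  rw [one_div]
  gcongr
  have := Real.pi_gt_three
  nlinarith

section Operators

/-- The total mass of `Φ` as a lower Lebesgue integral. -/
theorem lintegral_ofReal_eq_one (hΦ_nonneg : ∀ x, 0 ≤ Φ x) (hΦ_int : ∫ x, Φ x = 1) :
    ∫⁻ x, ENNReal.ofReal (Φ x) = 1 := by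
  rw [← ofReal_integral_eq_lintegral_ofReal, hΦ_int, ENNReal.ofReal_one]
  · by_contra hn
    rw [integral_undef hn] at hΦ_int
    exact zero_ne_one hΦ_int
  · exact Filter.Eventually.of_forall hΦ_nonneg

theorem phi_sq (hΦ_nonneg : ∀ x, 0 ≤ Φ x) (x : Plane) : phi Φ x ^ 2 = Φ x :=
  Real.sq_sqrt (hΦ_nonneg x)

theorem phi_nonneg (Φ : Plane → ℝ) (x : Plane) : 0 ≤ phi Φ x := Real.sqrt_nonneg _

theorem measurable_phi (hΦ : Measurable Φ) : Measurable (phi Φ) := hΦ.sqrt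

theorem measurable_heat_comp {Z : Type*} [MeasurableSpace Z] {f : Z → ℝ} {g : Z → Config n}
    (hf : Measurable f) (hg : Measurable g) :
    Measurable fun z => heat (f z) (g z) :=
  Measurable.comp (g := fun p : ℝ × Config n => heat p.1 p.2) (f := fun z => (f z, g z))
    measurable_heat (hf.prodMk hg)

/-- Each factor receives one full Φ, which gives the Schur test one localized relative coordinate in
each direction of integration. -/
theorem swapping_sq {Φ : Plane → ℝ} (hΦ_nonneg : ∀ x, 0 ≤ Φ x) (ε : ℝ) (α α' : Pair n) {t : ℝ}
    (ht : 0 < t) (y : RelConfig α) (y' : RelConfig α') :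
    swapping Φ ε α α' t y y' ^ 2 =
      (ENNReal.ofReal (Φ y'.1) * ENNReal.ofReal (heat t (S ε α y - S ε α' y'))) *
        (ENNReal.ofReal (Φ y.1) * ENNReal.ofReal (heat t (S ε α y - S ε α' y'))) := by
  rw [swapping, ENNReal.ofReal_mul (mul_nonneg (phi_nonneg Φ _) (heat_nonneg ht.le _)),
    ENNReal.ofReal_mul (phi_nonneg Φ _), mul_pow, mul_pow,
    ← ENNReal.ofReal_pow (phi_nonneg Φ _), ← ENNReal.ofReal_pow (phi_nonneg Φ _),
    phi_sq hΦ_nonneg, phi_sq hΦ_nonneg]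
  ring

variable (hΦ : Measurable Φ) (hΦ_nonneg : ∀ x, 0 ≤ Φ x) (hΦ_int : ∫ x, Φ x = 1)
include hΦ hΦ_nonneg hΦ_int

/-- Integrating the bare heat kernel over x costs 1; integrating Φ times the heat kernel over y
costs t⁻¹. The geometric mean is t^(-1/2), with constant 1. -/
theorem exists_incoming (ε : ℝ) {t : ℝ} (ht : 0 < t) (α : Pair n) :
    ∃ (T : Lp ℂ 2 (volume : Measure (Config n)) →L[ℂ] Lp ℂ 2 (volume : Measure (RelConfig α)))
      (Tstar : Lp ℂ 2 (volume : Measure (RelConfig α)) →L[ℂ]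
        Lp ℂ 2 (volume : Measure (Config n))),
      HasKernel (incoming Φ ε α t) T ∧ HasKernel (incomingStar Φ ε α t) Tstar ∧
        ‖T‖ = ‖Tstar‖ ∧ ‖T‖ ≤ t ^ (-(1 / 2) : ℝ) := by
  have hheat : Measurable fun p : RelConfig α × Config n =>
      heat t (S ε α p.1 - p.2) :=
    measurable_heat_comp measurable_const
      (((measurable_S ε α).comp measurable_fst).sub measurable_snd)
  have hrel : Measurable fun p : RelConfig α × Config n => p.1.1 :=
    measurable_fst.comp measurable_fst
  have hw : Measurable fun v => ENNReal.ofReal (Φ v) := hΦ.ennreal_ofReal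
  have hK : Measurable (Function.uncurry (incoming Φ ε α t)) := by
    have h : Measurable fun p : RelConfig α × Config n =>
        phi Φ p.1.1 * heat t (S ε α p.1 - p.2) := ((measurable_phi hΦ).comp hrel).mul hheat
    exact h.ennreal_ofReal
  have hle : ∀ y x, incoming Φ ε α t y x ^ 2 ≤ ENNReal.ofReal (heat t (S ε α y - x)) *
      (ENNReal.ofReal (Φ y.1) * ENNReal.ofReal (heat t (S ε α y - x))) := by
    intro y x
    rw [incoming, ENNReal.ofReal_mul (phi_nonneg Φ _), mul_pow,
      ← ENNReal.ofReal_pow (phi_nonneg Φ _), phi_sq hΦ_nonneg]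
    exact le_of_eq (by ring)
  have ha : ∀ y : RelConfig α, ∫⁻ x, ENNReal.ofReal (heat t (S ε α y - x)) ≤
      ENNReal.ofReal 1 := by
    intro y
    rw [lintegral_heat_sub ht, ENNReal.ofReal_one]
  have hb : ∀ x, ∫⁻ y : RelConfig α, ENNReal.ofReal (Φ y.1) *
      ENNReal.ofReal (heat t (S ε α y - x)) ≤ ENNReal.ofReal t⁻¹ := by
    intro x
    have h := lintegral_heat_S_le (fun v => ENNReal.ofReal_ne_top) hw ε α ht x
    rw [lintegral_ofReal_eq_one hΦ_nonneg hΦ_int, mul_one] at h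
    refine le_trans (le_of_eq (lintegral_congr fun y => ?_)) h
    rw [← heat_neg, neg_sub]
  obtain ⟨T, T', h1, h2, h3, h4⟩ := exists_operator_transpose_of_schur
    (K₁ := fun y x => ENNReal.ofReal (heat t (S ε α y - x)))
    (K₂ := fun y x => ENNReal.ofReal (Φ y.1) * ENNReal.ofReal (heat t (S ε α y - x)))
    hK hheat.ennreal_ofReal
    ((hw.comp hrel).mul hheat.ennreal_ofReal) hle zero_le_one (by positivity) ha hb
  refine ⟨T, T', h1, h2, h3, h4.trans (le_of_eq ?_)⟩
  rw [one_mul, Real.rpow_neg ht.le, Real.sqrt_inv, Real.sqrt_eq_rpow]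

/-- Both factors carry a Φ in the variable being integrated, so each costs t⁻¹; the relation between
the two pairs plays no role. -/
theorem exists_swapping (ε : ℝ) {t : ℝ} (ht : 0 < t) (α α' : Pair n) :
    ∃ T : Lp ℂ 2 (volume : Measure (RelConfig α')) →L[ℂ] Lp ℂ 2 (volume : Measure (RelConfig α)),
      HasKernel (swapping Φ ε α α' t) T ∧ ‖T‖ ≤ t⁻¹ := by
  have hdiff : Measurable fun p : RelConfig α × RelConfig α' => S ε α p.1 - S ε α' p.2 :=
    ((measurable_S ε α).comp measurable_fst).sub ((measurable_S ε α').comp measurable_snd)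
  have hheat : Measurable fun p : RelConfig α × RelConfig α' =>
      heat t (S ε α p.1 - S ε α' p.2) :=
    measurable_heat_comp measurable_const hdiff
  have hrel : Measurable fun p : RelConfig α × RelConfig α' => p.1.1 :=
    measurable_fst.comp measurable_fst
  have hrel' : Measurable fun p : RelConfig α × RelConfig α' => p.2.1 :=
    measurable_fst.comp measurable_snd
  have hw : Measurable fun v => ENNReal.ofReal (Φ v) := hΦ.ennreal_ofReal
  have hK : Measurable (Function.uncurry (swapping Φ ε α α' t)) := by
    have h : Measurable fun p : RelConfig α × RelConfig α' =>
        phi Φ p.1.1 * heat t (S ε α p.1 - S ε α' p.2) * phi Φ p.2.1 :=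
      (((measurable_phi hΦ).comp hrel).mul hheat).mul ((measurable_phi hΦ).comp hrel')
    exact h.ennreal_ofReal
  have hle : ∀ y y', swapping Φ ε α α' t y y' ^ 2 ≤
      (ENNReal.ofReal (Φ y'.1) * ENNReal.ofReal (heat t (S ε α y - S ε α' y'))) *
        (ENNReal.ofReal (Φ y.1) * ENNReal.ofReal (heat t (S ε α y - S ε α' y'))) :=
    fun y y' => (swapping_sq hΦ_nonneg ε α α' ht y y').le
  have ha : ∀ y : RelConfig α, ∫⁻ y' : RelConfig α', ENNReal.ofReal (Φ y'.1) *
      ENNReal.ofReal (heat t (S ε α y - S ε α' y')) ≤ ENNReal.ofReal t⁻¹ := by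
    intro y
    have h := lintegral_heat_S_le (fun v => ENNReal.ofReal_ne_top) hw ε α' ht (S ε α y)
    rwa [lintegral_ofReal_eq_one hΦ_nonneg hΦ_int, mul_one] at h
  have hb : ∀ y' : RelConfig α', ∫⁻ y : RelConfig α, ENNReal.ofReal (Φ y.1) *
      ENNReal.ofReal (heat t (S ε α y - S ε α' y')) ≤ ENNReal.ofReal t⁻¹ := by
    intro y'
    have h := lintegral_heat_S_le (fun v => ENNReal.ofReal_ne_top) hw ε α ht (S ε α' y')
    rw [lintegral_ofReal_eq_one hΦ_nonneg hΦ_int, mul_one] at h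
    refine le_trans (le_of_eq (lintegral_congr fun y => ?_)) h
    rw [← heat_neg, neg_sub]
  obtain ⟨T, h1, h4⟩ := exists_operator_of_schur
    (K₁ := fun y y' => ENNReal.ofReal (Φ y'.1) * ENNReal.ofReal (heat t (S ε α y - S ε α' y')))
    (K₂ := fun y y' => ENNReal.ofReal (Φ y.1) * ENNReal.ofReal (heat t (S ε α y - S ε α' y')))
    hK ((hw.comp hrel').mul hheat.ennreal_ofReal)
    ((hw.comp hrel).mul hheat.ennreal_ofReal) hle (by positivity) (by positivity) ha hb
  refine ⟨T, h1, h4.trans (le_of_eq ?_)⟩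
  exact Real.sqrt_mul_self (by positivity)

end Operators

end Swapping

/-! ### Integrals for the Laplace transform of the swapping operators -/

section LaplaceIntegrals

variable {n : ℕ}

/-- The integrand is the derivative of 1 - ρ/(√t + ρ), which rises from 0 to 1. It is the
scale-invariant majorant for the singular part of the time integral. -/
theorem lintegral_Ioi_deriv_le {ρ : ℝ} (hρ : 0 < ρ) :
    ∫⁻ t in Set.Ioi (0 : ℝ), ENNReal.ofReal (ρ / (2 * √t * (√t + ρ) ^ 2)) ≤ 1 := by
  have hd : ∀ t ∈ Set.Ioi (0 : ℝ), HasDerivAt (fun t => 1 - ρ / (√t + ρ))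
      (ρ / (2 * √t * (√t + ρ) ^ 2)) t := fun t ht => by
    have ht' : 0 < √t := Real.sqrt_pos.2 ht
    have h1 := ((Real.hasDerivAt_sqrt (ne_of_gt ht)).add_const ρ).inv (by positivity)
    refine ((h1.const_mul ρ).const_sub 1).congr_deriv ?_
    field_simp
  have hc : ContinuousWithinAt (fun t => 1 - ρ / (√t + ρ)) (Set.Ici 0) 0 := by
    refine ContinuousAt.continuousWithinAt ?_
    have : √0 + ρ ≠ 0 := by simp [hρ.ne']
    fun_prop (disch := assumption)
  have hpos : ∀ t ∈ Set.Ioi (0 : ℝ), 0 ≤ ρ / (2 * √t * (√t + ρ) ^ 2) := fun t _ => by positivity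
  have hlim : Filter.Tendsto (fun t => 1 - ρ / (√t + ρ)) Filter.atTop (nhds (1 - 0)) := by
    refine Filter.Tendsto.const_sub 1 (Filter.Tendsto.const_div_atTop ?_ ρ)
    exact Filter.tendsto_atTop_add_const_right _ _ Real.tendsto_sqrt_atTop
  have hi := integral_Ioi_of_hasDerivAt_of_nonneg hc hd hpos hlim
  have hint := integrableOn_Ioi_deriv_of_nonneg hc hd hpos hlim
  rw [← ofReal_integral_eq_lintegral_ofReal hint
    ((ae_restrict_iff' measurableSet_Ioi).2 (Filter.Eventually.of_forall hpos)), hi]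
  simp [hρ.ne']

/-- The value of the Gamma function at 1/2. -/
theorem lintegral_Ioi_exp_div_sqrt :
    ∫⁻ t in Set.Ioi (0 : ℝ), ENNReal.ofReal (Real.exp (-t) / √t) = ENNReal.ofReal √Real.pi := by
  have hc : Set.EqOn (fun t : ℝ => Real.exp (-t) * t ^ ((1 / 2 : ℝ) - 1))
      (fun t => Real.exp (-t) / √t) (Set.Ioi 0) := fun t ht => by
    simp only
    rw [Real.sqrt_eq_rpow, show ((1 / 2 : ℝ) - 1) = -(1 / 2) by norm_num,
      Real.rpow_neg (le_of_lt ht)]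
    exact (div_eq_mul_inv _ _).symm
  have h := (Real.GammaIntegral_convergent (s := 1 / 2) (by norm_num)).congr_fun hc
    measurableSet_Ioi
  rw [← ofReal_integral_eq_lintegral_ofReal h
    (Filter.Eventually.of_forall fun t => by positivity), ← Real.Gamma_one_half_eq,
    Real.Gamma_eq_integral (by norm_num), setIntegral_congr_fun measurableSet_Ioi hc]

/-- The time integral in the Schur test is bounded uniformly in the relative position. -/
theorem lintegral_time_le (r : Plane) :
    ∫⁻ t in Set.Ioi (0 : ℝ), ENNReal.ofReal (Real.exp (-t)) * (ENNReal.ofReal (√t)⁻¹ *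
      (ENNReal.ofReal (‖r‖ + t) * ENNReal.ofReal (hk (2 * t) r))) ≤ ENNReal.ofReal 18 := by
  have hpi := Real.pi_gt_three
  have hpt : ∀ t ∈ Set.Ioi (0 : ℝ), ENNReal.ofReal (Real.exp (-t)) * (ENNReal.ofReal (√t)⁻¹ *
      (ENNReal.ofReal (‖r‖ + t) * ENNReal.ofReal (hk (2 * t) r))) ≤
      ENNReal.ofReal 16 * ENNReal.ofReal (‖r‖ / (2 * √t * (√t + ‖r‖) ^ 2)) +
        ENNReal.ofReal (Real.exp (-t) / √t) := fun t ht => by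
    have ht0 : 0 < t := ht
    obtain ⟨s, hs, rfl⟩ : ∃ s, 0 < s ∧ t = s ^ 2 :=
      ⟨√t, Real.sqrt_pos.2 ht0, (Real.sq_sqrt ht0.le).symm⟩
    rw [Real.sqrt_sq hs.le, ← ENNReal.ofReal_mul (by positivity),
      ← ENNReal.ofReal_mul (by positivity), ← ENNReal.ofReal_mul (by positivity),
      ← ENNReal.ofReal_mul (by positivity), ← ENNReal.ofReal_add (by positivity) (by positivity)]
    refine ENNReal.ofReal_le_ofReal ?_
    set ρ := ‖r‖ with hρ
    have hρ0 : 0 ≤ ρ := norm_nonneg r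
    -- From 1 + x ≤ e^x with x = ρ²/(4s²): the Gaussian is replaced by a rational function that
    -- compares with the explicit derivative above.
    have hE : Real.exp (-ρ ^ 2 / (2 * (2 * s ^ 2))) ≤ 4 * s ^ 2 / (4 * s ^ 2 + ρ ^ 2) := by
      rw [neg_div, Real.exp_neg, inv_le_comm₀ (Real.exp_pos _) (by positivity)]
      refine le_trans (le_of_eq ?_) (Real.add_one_le_exp _)
      field_simp
      ring
    have hE1 : Real.exp (-ρ ^ 2 / (2 * (2 * s ^ 2))) ≤ 1 := by
      rw [Real.exp_le_one_iff, neg_div]; exact neg_nonpos.2 (by positivity)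
    have he1 : Real.exp (-s ^ 2) ≤ 1 := by
      rw [Real.exp_le_one_iff]; exact neg_nonpos.2 (by positivity)
    -- The distance ρ gives a scale-invariant term. The regularization t gives e^(-t)/√t, integrable
    -- at 0; a regularization by √t would have left a divergent 1/t.
    have hsplit : Real.exp (-s ^ 2) * (s⁻¹ * ((ρ + s ^ 2) * hk (2 * s ^ 2) r)) =
        Real.exp (-s ^ 2) * Real.exp (-ρ ^ 2 / (2 * (2 * s ^ 2))) * (ρ / s ^ 3 / (4 * Real.pi)) +
        (Real.exp (-s ^ 2) / s) * Real.exp (-ρ ^ 2 / (2 * (2 * s ^ 2))) * (1 / (4 * Real.pi)) := by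
      unfold hk
      rw [← hρ]
      field_simp
      ring
    rw [hsplit]
    refine add_le_add ?_ ?_
    · calc _ ≤ 1 * (4 * s ^ 2 / (4 * s ^ 2 + ρ ^ 2)) * (ρ / s ^ 3 / 1) := by
            gcongr; linarith
        _ ≤ 16 * (ρ / (2 * s * (s + ρ) ^ 2)) := by
            have : 1 * (4 * s ^ 2 / (4 * s ^ 2 + ρ ^ 2)) * (ρ / s ^ 3 / 1) =
              ρ * (4 / (s * (4 * s ^ 2 + ρ ^ 2))) := by field_simp
            rw [this, show 16 * (ρ / (2 * s * (s + ρ) ^ 2)) = ρ * (8 / (s * (s + ρ) ^ 2)) by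
              field_simp; ring]
            refine mul_le_mul_of_nonneg_left ?_ hρ0
            rw [div_le_div_iff₀ (by positivity) (by positivity)]
            -- This is (s + ρ)² ≤ 2(s² + ρ²) ≤ 2(4s² + ρ²).
            nlinarith [sq_nonneg (s - ρ), mul_pos hs hs, mul_nonneg hs.le (sq_nonneg (s - ρ)),
              mul_nonneg hs.le (sq_nonneg s)]
    · calc _ ≤ Real.exp (-s ^ 2) / s * 1 * 1 := by
            gcongr
            rw [div_le_one (by positivity)]; linarith
        _ = _ := by ring
  refine (setLIntegral_mono' measurableSet_Ioi hpt).trans ?_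
  have hm : Measurable fun t : ℝ => ENNReal.ofReal (Real.exp (-t) / √t) := by fun_prop
  rw [lintegral_add_right _ hm, lintegral_const_mul' _ _ ENNReal.ofReal_ne_top,
    lintegral_Ioi_exp_div_sqrt]
  have h1 : ∫⁻ t in Set.Ioi (0 : ℝ), ENNReal.ofReal (‖r‖ / (2 * √t * (√t + ‖r‖) ^ 2)) ≤ 1 := by
    rcases (norm_nonneg r).eq_or_lt with h | h
    · simp [← h]
    · exact lintegral_Ioi_deriv_le h
  have h2 : √Real.pi ≤ 2 := by
    rw [Real.sqrt_le_left (by norm_num)]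
    linarith [Real.pi_le_four]
  calc _ ≤ ENNReal.ofReal 16 * 1 + ENNReal.ofReal 2 := by gcongr
    _ = _ := by rw [mul_one, ← ENNReal.ofReal_add (by norm_num) (by norm_num)]; norm_num

/-- The regularized distance between the two particles of a pair. -/
noncomputable def pairGap (α : Pair n) (t : ℝ) (Z : Config n) : ℝ := ‖Z α.1.1 - Z α.1.2‖ + t

theorem pairGap_pos (α : Pair n) {t : ℝ} (ht : 0 < t) (Z : Config n) : 0 < pairGap α t Z := by
  unfold pairGap; positivity

theorem pairGap_neg (α : Pair n) (t : ℝ) (Z : Config n) : pairGap α t (-Z) = pairGap α t Z := by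
  simp only [pairGap, Pi.neg_apply]
  rw [← neg_sub', norm_neg]

theorem measurable_pairGap (α : Pair n) :
    Measurable fun p : ℝ × Config n => pairGap α p.1 p.2 := by
  unfold pairGap; fun_prop

theorem S_update_self (ε : ℝ) (α : Pair n) (v m x : Plane) (z : Rest α → Plane) (k : Rest α) :
    S ε α (v, m, Function.update z k x) k = x := by
  rw [S_rest]
  exact Function.update_self _ _ _

theorem S_update_of_ne (ε : ℝ) (α : Pair n) (v m x : Plane) (z : Rest α → Plane) (k : Rest α)
    {l : Fin n} (hl : l ≠ k) :
    S ε α (v, m, Function.update z k x) l = S ε α (v, m, z) l := by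
  unfold S
  split_ifs with h1 h2
  · rfl
  · rfl
  · exact Function.update_of_ne (fun h => hl (congrArg Subtype.val h)) _ _

/-- Some label of `α` does not belong to a different pair `α'`. -/
theorem exists_label_notMem {α α' : Pair n} (h : α ≠ α') :
    ∃ (k : Rest α') (l : Fin n), l ≠ k ∧
      (∀ (t : ℝ) (Z : Config n), pairGap α t Z = ‖Z k - Z l‖ + t) := by
  by_cases h1 : α.1.1 ≠ α'.1.1 ∧ α.1.1 ≠ α'.1.2
  · exact ⟨⟨α.1.1, h1⟩, α.1.2, α.2.ne', fun t Z => rfl⟩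
  · by_cases h2 : α.1.2 ≠ α'.1.1 ∧ α.1.2 ≠ α'.1.2
    · exact ⟨⟨α.1.2, h2⟩, α.1.1, α.2.ne, fun t Z => by rw [pairGap, norm_sub_rev]⟩
    -- Both labels of α lie in α', and the increasing order inside each pair forces α = α'.
    · exfalso
      apply h
      have hα := α.2
      have hα' := α'.2
      refine Subtype.ext (Prod.ext ?_ ?_) <;> grind

/-- The heat kernel of the free particles regularizes the inverse distance in a pair `α ≠ α'`. -/
theorem exists_lintegral_rest_le : ∃ C : ℝ, 0 < C ∧ ∀ {n : ℕ} {α α' : Pair n}, α ≠ α' →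
    ∀ (ε t : ℝ), 0 < t → ∀ (X : Config n) (v m : Plane),
      ∫⁻ z : Rest α' → Plane, (∏ k : Rest α', ENNReal.ofReal (hk t (X k - z k))) *
        ENNReal.ofReal (pairGap α t (X - S ε α' (v, m, z)))⁻¹ ≤ ENNReal.ofReal (C / √t) := by
  obtain ⟨C, hC0, hC⟩ := exists_lintegral_hk_mul_inv_le
  refine ⟨C, hC0, fun {n α α'} hne ε t ht X v m => ?_⟩
  obtain ⟨k, l, hl, hgap⟩ := exists_label_notMem hne
  have hm : Measurable fun z : Rest α' → Plane =>
      ENNReal.ofReal (pairGap α t (X - S ε α' (v, m, z)))⁻¹ := by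
    have h1 : Measurable fun z : Rest α' → Plane => X - S ε α' (v, m, z) :=
      measurable_const.sub ((measurable_S ε α').comp
        (measurable_const.prodMk (measurable_const.prodMk measurable_id)))
    exact (Measurable.comp (g := fun p : ℝ × Config n => pairGap α p.1 p.2)
      (f := fun z => (t, X - S ε α' (v, m, z))) (measurable_pairGap α)
      (measurable_const.prodMk h1)).inv.ennreal_ofReal
  -- Particle k belongs to α but is free with respect to α'. While it alone is integrated, its
  -- partner l stays at a fixed point, so the estimate for a single plane variable applies.
  refine lintegral_prod_hk_mul_le ht (fun k : Rest α' => X k) k hm fun z => ?_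
  refine le_trans (le_of_eq ?_) (hC t ht (X l - S ε α' (v, m, z) l))
  rw [← lintegral_sub_left_eq_self _ (X k)]
  refine lintegral_congr fun x => ?_
  rw [hgap]
  simp only [Pi.sub_apply, S_update_self, S_update_of_ne _ _ _ _ _ _ _ hl, sub_sub_cancel]

/-- The gap of the pair whose configurations are integrated sees only the relative coordinate. It
can therefore serve as the factor `A` in `lintegral_heat_S_mul_le`, the inverse gap of the other
pair being the factor `B`. -/
theorem pairGap_sub_S (α : Pair n) (ε t : ℝ) (X : Config n) (y : RelConfig α) :
    pairGap α t (X - S ε α y) = ‖X α.1.1 - X α.1.2 - ε • y.1‖ + t := by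
  have h : (X - S ε α y) α.1.1 - (X - S ε α y) α.1.2 = X α.1.1 - X α.1.2 - ε • y.1 := by
    rw [Pi.sub_apply, Pi.sub_apply, S_fst, S_snd]
    module
  rw [pairGap, h]

/-- The spatial integral in the Schur test for `α ≠ α'`. -/
theorem exists_lintegral_weighted_heat_le : ∃ C : ℝ, 0 < C ∧ ∀ {n : ℕ} {α α' : Pair n}, α ≠ α' →
    ∀ {w : Plane → ℝ≥0∞}, (∀ v, w v ≠ ⊤) → ∀ (ε t : ℝ), 0 < t → ∀ (X : Config n),
      ∫⁻ y : RelConfig α', w y.1 * ENNReal.ofReal (heat t (X - S ε α' y)) *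
        (ENNReal.ofReal (pairGap α' t (X - S ε α' y)) *
          ENNReal.ofReal (pairGap α t (X - S ε α' y))⁻¹) ≤
      ∫⁻ v, w v * (ENNReal.ofReal C * (ENNReal.ofReal (√t)⁻¹ *
        (ENNReal.ofReal (‖X α'.1.1 - X α'.1.2 - ε • v‖ + t) *
          ENNReal.ofReal (hk (2 * t) (X α'.1.1 - X α'.1.2 - ε • v))))) := by
  obtain ⟨C, hC0, hC⟩ := exists_lintegral_rest_le
  refine ⟨C, hC0, fun {n α α'} hne {w} hw ε t ht X => ?_⟩
  have h := lintegral_heat_S_mul_le hw ε α' ht X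
    (A := fun r => ENNReal.ofReal (‖r‖ + t))
    (B := fun Z => ENNReal.ofReal (pairGap α t Z)⁻¹) (C := ENNReal.ofReal (C / √t))
    (fun _ => ENNReal.ofReal_ne_top) (fun v m => hC hne ε t ht X v m)
  refine le_trans (le_of_eq (lintegral_congr fun y => ?_))
    (h.trans (le_of_eq (lintegral_congr fun v => ?_)))
  · rw [pairGap_sub_S α' ε t X y]
  · rw [div_eq_mul_inv, ENNReal.ofReal_mul hC0.le]
    ring

end LaplaceIntegrals

/-! ### The Laplace transform of the swapping operators -/

section Laplace

variable {n : ℕ}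

/-- The integrand of the weighted kernels in the Schur test for the Laplace integral. -/
noncomputable def schurIntegrand (w : Plane → ℝ≥0∞) (α α' : Pair n) (v : Plane) (t : ℝ)
    (Z : Config n) : ℝ≥0∞ :=
  ENNReal.ofReal (Real.exp (-t)) * (w v * ENNReal.ofReal (heat t Z) *
    (ENNReal.ofReal (pairGap α' t Z) * ENNReal.ofReal (pairGap α t Z)⁻¹))

/-- This symmetry turns the column bound into the row bound with the two pairs exchanged. -/
theorem schurIntegrand_neg (w : Plane → ℝ≥0∞) (α α' : Pair n) (v : Plane) (t : ℝ)
    (Z : Config n) : schurIntegrand w α α' v t (-Z) = schurIntegrand w α α' v t Z := by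
  simp only [schurIntegrand, heat_neg, pairGap_neg]

theorem measurable_schurIntegrand {w : Plane → ℝ≥0∞} (hw : Measurable w) (α α' : Pair n)
    {Y : Type*} [MeasurableSpace Y] {v : Y → Plane} {t : Y → ℝ} {Z : Y → Config n}
    (hv : Measurable v) (ht : Measurable t) (hZ : Measurable Z) :
    Measurable fun y => schurIntegrand w α α' (v y) (t y) (Z y) := by
  have hgap : ∀ β : Pair n, Measurable fun y => pairGap β (t y) (Z y) := fun β =>
    Measurable.comp (g := fun p : ℝ × Config n => pairGap β p.1 p.2) (f := fun y => (t y, Z y))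
      (measurable_pairGap β) (ht.prodMk hZ)
  have h1 : Measurable fun y => ENNReal.ofReal (Real.exp (-t y)) :=
    (Real.measurable_exp.comp ht.neg).ennreal_ofReal
  have h2 : Measurable fun y => w (v y) := hw.comp hv
  exact h1.mul ((h2.mul (measurable_heat_comp ht hZ).ennreal_ofReal).mul
    ((hgap α').ennreal_ofReal.mul (hgap α).inv.ennreal_ofReal))

/-- Space is integrated at fixed t, which yields C/√t; then time at fixed relative coordinate v,
which yields 18 whatever v and ε are; finally v against the probability density `w`. -/
theorem exists_lintegral_schurIntegrand_le : ∃ C : ℝ, 0 < C ∧ ∀ {n : ℕ} {α α' : Pair n}, α ≠ α' →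
    ∀ {w : Plane → ℝ≥0∞}, (∀ v, w v ≠ ⊤) → Measurable w → ∫⁻ v, w v = 1 →
    ∀ (ε : ℝ) (X : Config n),
      ∫⁻ y : RelConfig α', ∫⁻ t in Set.Ioi (0 : ℝ),
        schurIntegrand w α α' y.1 t (X - S ε α' y) ≤ ENNReal.ofReal C := by
  obtain ⟨C, hC0, hC⟩ := exists_lintegral_weighted_heat_le
  refine ⟨C * 18, by positivity, fun {n α α'} hne {w} hwt hw hw1 ε X => ?_⟩
  have hm : Measurable fun p : RelConfig α' × ℝ =>
      schurIntegrand w α α' p.1.1 p.2 (X - S ε α' p.1) :=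
    measurable_schurIntegrand hw α α' (measurable_fst.comp measurable_fst) measurable_snd
      (measurable_const.sub ((measurable_S ε α').comp measurable_fst))
  let r : Plane → Plane := fun v => X α'.1.1 - X α'.1.2 - ε • v
  have hr : Measurable r := by fun_prop
  let F : Plane → ℝ → ℝ≥0∞ := fun v t => ENNReal.ofReal (Real.exp (-t)) *
    (ENNReal.ofReal (√t)⁻¹ * (ENNReal.ofReal (‖r v‖ + t) * ENNReal.ofReal (hk (2 * t) (r v))))
  have hF : Measurable fun p : ℝ × Plane => F p.2 p.1 := by
    have h1 : Measurable fun p : ℝ × Plane => hk (2 * p.1) (r p.2) :=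
      Measurable.comp (g := fun p : ℝ × Plane => hk p.1 p.2)
        (f := fun p : ℝ × Plane => (2 * p.1, r p.2)) measurable_hk (by fun_prop)
    have h2 := h1.ennreal_ofReal
    simp only [F]
    fun_prop
  calc ∫⁻ y : RelConfig α', ∫⁻ t in Set.Ioi (0 : ℝ), schurIntegrand w α α' y.1 t (X - S ε α' y)
      = ∫⁻ t in Set.Ioi (0 : ℝ), ∫⁻ y : RelConfig α',
          schurIntegrand w α α' y.1 t (X - S ε α' y) := by
        rw [lintegral_lintegral_swap hm.aemeasurable]
    _ ≤ ∫⁻ t in Set.Ioi (0 : ℝ), ∫⁻ v, ENNReal.ofReal C * (w v * F v t) := by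
        refine setLIntegral_mono' measurableSet_Ioi fun t ht => ?_
        simp only [schurIntegrand]
        rw [lintegral_const_mul' _ _ ENNReal.ofReal_ne_top]
        refine (mul_le_mul_right (hC hne hwt ε t ht X) _).trans (le_of_eq ?_)
        rw [← lintegral_const_mul' _ _ ENNReal.ofReal_ne_top]
        refine lintegral_congr fun v => ?_
        simp only [F, r]
        ring
    _ = ∫⁻ v, ∫⁻ t in Set.Ioi (0 : ℝ), ENNReal.ofReal C * (w v * F v t) := by
        rw [lintegral_lintegral_swap]
        exact (((hw.comp measurable_snd).mul hF).const_mul _).aemeasurable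
    _ ≤ ∫⁻ v, ENNReal.ofReal (C * 18) * w v := by
        refine lintegral_mono fun v => ?_
        rw [lintegral_const_mul' _ _ ENNReal.ofReal_ne_top, lintegral_const_mul' _ _ (hwt v),
          ENNReal.ofReal_mul hC0.le, mul_assoc, mul_comm _ (w v)]
        gcongr
        exact lintegral_time_le (r v)
    _ = ENNReal.ofReal (C * 18) := by rw [lintegral_const_mul _ hw, hw1, mul_one]

theorem measurable_swapping {Φ : Plane → ℝ} (hΦ : Measurable Φ) (ε : ℝ) (α α' : Pair n) :
    Measurable fun p : (RelConfig α × RelConfig α') × ℝ =>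
      swapping Φ ε α α' p.2 p.1.1 p.1.2 := by
  have h1 : Measurable fun p : (RelConfig α × RelConfig α') × ℝ => p.1.1.1 :=
    measurable_fst.comp (measurable_fst.comp measurable_fst)
  have h2 : Measurable fun p : (RelConfig α × RelConfig α') × ℝ => p.1.2.1 :=
    measurable_fst.comp (measurable_snd.comp measurable_fst)
  have h3 : Measurable fun p : (RelConfig α × RelConfig α') × ℝ =>
      S ε α p.1.1 - S ε α' p.1.2 :=
    ((measurable_S ε α).comp (measurable_fst.comp measurable_fst)).sub
      ((measurable_S ε α').comp (measurable_snd.comp measurable_fst))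
  exact ((((measurable_phi hΦ).comp h1).mul (measurable_heat_comp measurable_snd h3)).mul
    ((measurable_phi hΦ).comp h2)).ennreal_ofReal

/-- The two Schur kernels are time integrals weighted by the gap ratio and by its inverse;
Cauchy-Schwarz in t removes the ratio again. -/
theorem exists_swappingLaplace : ∃ C : ℝ, 0 < C ∧ ∀ {Φ : Plane → ℝ}, Measurable Φ →
    (∀ x, 0 ≤ Φ x) → ∫ x, Φ x = 1 → ∀ {n : ℕ} (ε : ℝ) (α α' : Pair n), α ≠ α' →
    ∃ T : Lp ℂ 2 (volume : Measure (RelConfig α')) →L[ℂ] Lp ℂ 2 (volume : Measure (RelConfig α)),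
      HasKernel (swappingLaplace Φ ε α α') T ∧ ‖T‖ ≤ C := by
  obtain ⟨C, hC0, hC⟩ := exists_lintegral_schurIntegrand_le
  refine ⟨C, hC0, fun {Φ} hΦ hΦ_nonneg hΦ_int {n} ε α α' hne => ?_⟩
  have hw : Measurable fun v => ENNReal.ofReal (Φ v) := hΦ.ennreal_ofReal
  have hw1 := lintegral_ofReal_eq_one hΦ_nonneg hΦ_int
  have hwt : ∀ v, ENNReal.ofReal (Φ v) ≠ ⊤ := fun v => ENNReal.ofReal_ne_top
  have hdiff : Measurable fun p : (RelConfig α × RelConfig α') × ℝ =>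
      S ε α p.1.1 - S ε α' p.1.2 :=
    ((measurable_S ε α).comp (measurable_fst.comp measurable_fst)).sub
      ((measurable_S ε α').comp (measurable_snd.comp measurable_fst))
  have hm₁ : Measurable fun p : (RelConfig α × RelConfig α') × ℝ => schurIntegrand
      (fun v => ENNReal.ofReal (Φ v)) α α' p.1.2.1 p.2 (S ε α p.1.1 - S ε α' p.1.2) :=
    measurable_schurIntegrand hw α α' (measurable_fst.comp (measurable_snd.comp measurable_fst))
      measurable_snd hdiff
  have hm₂ : Measurable fun p : (RelConfig α × RelConfig α') × ℝ => schurIntegrand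
      (fun v => ENNReal.ofReal (Φ v)) α' α p.1.1.1 p.2 (S ε α p.1.1 - S ε α' p.1.2) :=
    measurable_schurIntegrand hw α' α (measurable_fst.comp (measurable_fst.comp measurable_fst))
      measurable_snd hdiff
  have hexp : Measurable fun t : ℝ => ENNReal.ofReal (Real.exp (-t)) := by fun_prop
  have hK : Measurable (Function.uncurry (swappingLaplace Φ ε α α')) :=
    ((hexp.comp measurable_snd).mul (measurable_swapping hΦ ε α α')).lintegral_prod_right'
  have hle : ∀ y y', swappingLaplace Φ ε α α' y y' ^ 2 ≤
      (∫⁻ t in Set.Ioi (0 : ℝ), schurIntegrand (fun v => ENNReal.ofReal (Φ v)) α α' y'.1 t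
        (S ε α y - S ε α' y')) *
      ∫⁻ t in Set.Ioi (0 : ℝ), schurIntegrand (fun v => ENNReal.ofReal (Φ v)) α' α y.1 t
        (S ε α y - S ε α' y') := fun y y' => by
    refine sq_lintegral_le_of_sq_le _ ?_ ?_ ?_
    · exact (hm₁.comp (f := fun t => ((y, y'), t)) (by fun_prop)).aemeasurable
    · exact (hm₂.comp (f := fun t => ((y, y'), t)) (by fun_prop)).aemeasurable
    · refine (ae_restrict_iff' measurableSet_Ioi).2 (Filter.Eventually.of_forall fun t ht => ?_)
      rw [mul_pow, swapping_sq hΦ_nonneg ε α α' ht]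
      set Z := S ε α y - S ε α' y'
      -- The ratios cancel exactly because the term t keeps both gaps positive, even when particles
      -- coincide.
      have hg : ∀ β : Pair n, ENNReal.ofReal (pairGap β t Z) *
          ENNReal.ofReal (pairGap β t Z)⁻¹ = 1 := fun β => by
        rw [← ENNReal.ofReal_mul (pairGap_pos β ht Z).le,
          mul_inv_cancel₀ (pairGap_pos β ht Z).ne', ENNReal.ofReal_one]
      refine le_of_eq ?_
      simp only [schurIntegrand]
      calc _ = ENNReal.ofReal (Real.exp (-t)) ^ 2 *
            ((ENNReal.ofReal (Φ y'.1) * ENNReal.ofReal (heat t Z)) *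
              (ENNReal.ofReal (Φ y.1) * ENNReal.ofReal (heat t Z))) *
            (ENNReal.ofReal (pairGap α t Z) * ENNReal.ofReal (pairGap α t Z)⁻¹) *
            (ENNReal.ofReal (pairGap α' t Z) * ENNReal.ofReal (pairGap α' t Z)⁻¹) := by
            rw [hg, hg, mul_one, mul_one]
        _ = _ := by ring
  have ha : ∀ y : RelConfig α, ∫⁻ y' : RelConfig α', ∫⁻ t in Set.Ioi (0 : ℝ),
      schurIntegrand (fun v => ENNReal.ofReal (Φ v)) α α' y'.1 t (S ε α y - S ε α' y') ≤
        ENNReal.ofReal C := fun y => hC hne hwt hw hw1 ε (S ε α y)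
  have hb : ∀ y' : RelConfig α', ∫⁻ y : RelConfig α, ∫⁻ t in Set.Ioi (0 : ℝ),
      schurIntegrand (fun v => ENNReal.ofReal (Φ v)) α' α y.1 t (S ε α y - S ε α' y') ≤
        ENNReal.ofReal C := fun y' => by
    refine le_trans (le_of_eq (lintegral_congr fun y => lintegral_congr fun t => ?_))
      (hC hne.symm hwt hw hw1 ε (S ε α' y'))
    rw [← schurIntegrand_neg, neg_sub]
  obtain ⟨T, hT, hTn⟩ := exists_operator_of_schur
    (K₁ := fun y y' => ∫⁻ t in Set.Ioi (0 : ℝ), schurIntegrand (fun v => ENNReal.ofReal (Φ v))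
      α α' y'.1 t (S ε α y - S ε α' y'))
    (K₂ := fun y y' => ∫⁻ t in Set.Ioi (0 : ℝ), schurIntegrand (fun v => ENNReal.ofReal (Φ v))
      α' α y.1 t (S ε α y - S ε α' y'))
    hK hm₁.lintegral_prod_right' hm₂.lintegral_prod_right' hle hC0.le hC0.le ha hb
  exact ⟨T, hT, hTn.trans (le_of_eq (Real.sqrt_mul_self hC0.le))⟩

end Laplace

/-! ### Convolution powers -/

/-- Convolution powers on the real line: `convPow g m` is the `(m + 1)`-fold power of `g`. -/
noncomputable def convPow (g : ℝ → ℝ≥0∞) : ℕ → ℝ → ℝ≥0∞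
  | 0 => g
  | m + 1 => fun t => ∫⁻ s, g s * convPow g m (t - s)

section ConvPow

variable {g : ℝ → ℝ≥0∞} (hg : Measurable g)
include hg

theorem measurable_convPow (m : ℕ) : Measurable (convPow g m) := by
  induction m with
  | zero => exact hg
  | succ m ih =>
    have h : Measurable fun p : ℝ × ℝ => g p.2 * convPow g m (p.1 - p.2) := by fun_prop
    exact h.lintegral_prod_right'

/-- The mass of a convolution is the product of the masses; `convPow g m` has m + 1 factors. -/
theorem lintegral_convPow (m : ℕ) : ∫⁻ t, convPow g m t = (∫⁻ t, g t) ^ (m + 1) := by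
  induction m with
  | zero => simp [convPow]
  | succ m ih =>
    have hm := measurable_convPow hg m
    simp only [convPow]
    rw [lintegral_lintegral_swap (by fun_prop)]
    have h : ∀ s, ∫⁻ t, g s * convPow g m (t - s) = g s * (∫⁻ t, g t) ^ (m + 1) := fun s => by
      rw [lintegral_const_mul _ (by fun_prop), lintegral_sub_right_eq_self (convPow g m) s, ih]
    simp_rw [h]
    rw [lintegral_mul_const _ hg, pow_succ', pow_succ', pow_succ']

/-- One factor is bounded by its supremum, the m others by their mass. This serves the range t ≤ ε²,
where 1/t is too large. -/
theorem convPow_le {b : ℝ≥0∞} (hb : ∀ s, g s ≤ b) (m : ℕ) (t : ℝ) :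
    convPow g m t ≤ b * (∫⁻ t, g t) ^ m := by
  induction m generalizing t with
  | zero => simpa [convPow] using hb t
  | succ m ih =>
    calc convPow g (m + 1) t ≤ ∫⁻ s, g s * (b * (∫⁻ t, g t) ^ m) := by
          simp only [convPow]; gcongr; exact ih _
      _ = b * (∫⁻ t, g t) ^ (m + 1) := by
          rw [lintegral_mul_const _ hg, pow_succ]; ring

/-- The pointwise bound on convolution powers by size biasing. -/
theorem ofReal_mul_convPow_le {D : ℝ≥0∞} (hD : ∀ s, ENNReal.ofReal s * g s ≤ D) (m : ℕ) (t : ℝ) :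
    ENNReal.ofReal t * convPow g m t ≤ (m + 1) * D * (∫⁻ t, g t) ^ m := by
  induction m generalizing t with
  | zero => simpa [convPow] using hD t
  | succ m ih =>
    have hm := measurable_convPow hg m
    calc ENNReal.ofReal t * convPow g (m + 1) t
        = ∫⁻ s, ENNReal.ofReal t * (g s * convPow g m (t - s)) := by
          simp only [convPow]; rw [lintegral_const_mul _ (by fun_prop)]
      _ ≤ ∫⁻ s, (D * convPow g m (t - s) + g s * ((m + 1) * D * (∫⁻ t, g t) ^ m)) := by
          refine lintegral_mono fun s => ?_
          calc ENNReal.ofReal t * (g s * convPow g m (t - s))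
              ≤ (ENNReal.ofReal s + ENNReal.ofReal (t - s)) * (g s * convPow g m (t - s)) := by
                gcongr
                -- Size biasing: t = s + (t - s), and each summand is paired with the factor living
                -- at that time.
                refine le_trans (le_of_eq ?_) ENNReal.ofReal_add_le
                rw [add_sub_cancel]
            _ = (ENNReal.ofReal s * g s) * convPow g m (t - s) +
                  g s * (ENNReal.ofReal (t - s) * convPow g m (t - s)) := by ring
            _ ≤ _ := add_le_add (mul_le_mul_left (hD s) _) (mul_le_mul_right (ih _) _)
      _ = (↑(m + 1) + 1) * D * (∫⁻ t, g t) ^ (m + 1) := by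
          rw [lintegral_add_left (by fun_prop), lintegral_const_mul _ (by fun_prop),
            lintegral_sub_left_eq_self (convPow g m) t, lintegral_convPow hg,
            lintegral_mul_const _ hg]
          push_cast
          ring

end ConvPow

/-- The discounted bound on the norm of `φ p_ε(2t) φ`. -/
noncomputable def discounted (l b : ℝ) (t : ℝ) : ℝ≥0∞ :=
  (Set.Ioi (0 : ℝ)).indicator
    (fun t => ENNReal.ofReal (Real.exp (-(l * t)) * min (1 / (4 * Real.pi * t)) b)) t

theorem measurable_discounted (l b : ℝ) : Measurable (discounted l b) :=
  Measurable.indicator (by fun_prop) measurableSet_Ioi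

theorem discounted_le {l b : ℝ} (hl : 0 ≤ l) (hb : 0 ≤ b) (t : ℝ) :
    discounted l b t ≤ ENNReal.ofReal b := by
  unfold discounted
  refine Set.indicator_apply_le' (fun ht => ?_) (fun _ => bot_le)
  have ht0 : (0 : ℝ) < t := ht
  refine ENNReal.ofReal_le_ofReal ?_
  have he : Real.exp (-(l * t)) ≤ 1 := by
    rw [Real.exp_le_one_iff]; exact neg_nonpos.2 (by positivity)
  calc Real.exp (-(l * t)) * min (1 / (4 * Real.pi * t)) b ≤ 1 * b := by
        gcongr
        exact min_le_right _ _
    _ = b := one_mul b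

/-- This supplies the constant for size biasing; 4π comes from the heat kernel at time 2t. -/
theorem ofReal_mul_discounted_le {l b : ℝ} (hl : 0 ≤ l) (hb : 0 ≤ b) (t : ℝ) :
    ENNReal.ofReal t * discounted l b t ≤ ENNReal.ofReal (1 / (4 * Real.pi)) := by
  by_cases ht : t ∈ Set.Ioi (0 : ℝ)
  · have ht0 : (0 : ℝ) < t := ht
    have he : Real.exp (-(l * t)) ≤ 1 := by
      rw [Real.exp_le_one_iff]; exact neg_nonpos.2 (by positivity)
    rw [discounted, Set.indicator_of_mem ht, ← ENNReal.ofReal_mul ht0.le]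
    refine ENNReal.ofReal_le_ofReal ?_
    calc t * (Real.exp (-(l * t)) * min (1 / (4 * Real.pi * t)) b)
        ≤ t * (1 * (1 / (4 * Real.pi * t))) := by
          gcongr
          exact min_le_left _ _
      _ = 1 / (4 * Real.pi) := by field_simp
  · rw [discounted, Set.indicator_of_notMem ht, mul_zero]
    exact zero_le

/-- The total mass of the discounted bound. -/
theorem lintegral_discounted_le {l M ε : ℝ} (hl : 0 < l) (hM : 0 ≤ M) (hε : 0 < ε)
    (hlε : l * ε ^ 2 ≤ 1) :
    ∫⁻ t, discounted l (M / ε ^ 2) t ≤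
      ENNReal.ofReal (M + 1 / (4 * Real.pi) + Real.log (1 / (l * ε ^ 2)) / (4 * Real.pi)) := by
  have hpi := Real.pi_pos
  have hle : ε ^ 2 ≤ 1 / l := by rw [le_div_iff₀ hl]; linarith
  have hlog : 0 ≤ Real.log (1 / (l * ε ^ 2)) :=
    Real.log_nonneg (by rw [le_div_iff₀ (by positivity)]; linarith)
  -- Three ranges: the plateau M/ε² up to ε² has mass M, the tail 1/(4πt) up to 1/l gives the
  -- logarithm, and beyond 1/l the discount leaves at most 1/(4π).
  have hpt : ∀ t, discounted l (M / ε ^ 2) t ≤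
      ((Set.Ioc 0 (ε ^ 2)).indicator (fun _ => ENNReal.ofReal (M / ε ^ 2)) t +
      (Set.Ioc (ε ^ 2) (1 / l)).indicator (fun t => ENNReal.ofReal (1 / (4 * Real.pi) * t⁻¹)) t) +
      (Set.Ioi (1 / l)).indicator
        (fun t => ENNReal.ofReal (l / (4 * Real.pi) * Real.exp (-l * t))) t := fun t => by
    by_cases ht : 0 < t
    swap
    · rw [discounted, Set.indicator_of_notMem (by simpa using ht)]; exact zero_le
    have he : Real.exp (-(l * t)) ≤ 1 := by
      rw [Real.exp_le_one_iff]; exact neg_nonpos.2 (by positivity)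
    by_cases h1 : t ≤ ε ^ 2
    · refine (discounted_le hl.le (by positivity) t).trans ?_
      rw [Set.indicator_of_mem (show t ∈ Set.Ioc 0 (ε ^ 2) from ⟨ht, h1⟩), add_assoc]
      exact le_self_add
    push Not at h1
    rw [discounted, Set.indicator_of_mem (show t ∈ Set.Ioi (0 : ℝ) from ht)]
    by_cases h2 : t ≤ 1 / l
    · rw [Set.indicator_of_mem (show t ∈ Set.Ioc (ε ^ 2) (1 / l) from ⟨h1, h2⟩)]
      refine le_trans ?_ (le_add_right (le_add_left le_rfl))
      refine ENNReal.ofReal_le_ofReal ?_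
      calc _ ≤ 1 * (1 / (4 * Real.pi * t)) := by gcongr; exact min_le_left _ _
        _ = _ := by field_simp
    push Not at h2
    rw [Set.indicator_of_mem (show t ∈ Set.Ioi (1 / l) from h2)]
    refine le_trans (ENNReal.ofReal_le_ofReal ?_) (le_add_left le_rfl)
    rw [mul_comm, neg_mul]
    gcongr
    refine (min_le_left _ _).trans ?_
    rw [div_le_div_iff₀ (by positivity) (by positivity)]
    rw [div_lt_iff₀ hl] at h2
    nlinarith
  refine (lintegral_mono hpt).trans ?_
  rw [lintegral_add_left, lintegral_add_left, lintegral_indicator measurableSet_Ioc,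
    lintegral_indicator measurableSet_Ioc, lintegral_indicator measurableSet_Ioi]
  rotate_left
  · exact measurable_const.indicator measurableSet_Ioc
  · exact (measurable_const.indicator measurableSet_Ioc).add
      (Measurable.indicator (by fun_prop) measurableSet_Ioc)
  have e1 : ∫⁻ _ in Set.Ioc 0 (ε ^ 2), ENNReal.ofReal (M / ε ^ 2) = ENNReal.ofReal M := by
    rw [setLIntegral_const, Real.volume_Ioc, sub_zero, ← ENNReal.ofReal_mul (by positivity)]
    congr 1
    field_simp
  have e2 : ∫⁻ t in Set.Ioc (ε ^ 2) (1 / l), ENNReal.ofReal (1 / (4 * Real.pi) * t⁻¹) =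
      ENNReal.ofReal (Real.log (1 / (l * ε ^ 2)) / (4 * Real.pi)) := by
    have hi : IntervalIntegrable (fun t : ℝ => t⁻¹) volume (ε ^ 2) (1 / l) := by
      refine intervalIntegral.intervalIntegrable_inv (fun x hx => ?_) continuousOn_id
      rw [Set.uIcc_of_le hle] at hx
      exact ((by positivity : 0 < ε ^ 2).trans_le hx.1).ne'
    rw [← ofReal_integral_eq_lintegral_ofReal, integral_const_mul,
      ← intervalIntegral.integral_of_le hle, integral_inv_of_pos (by positivity) (by positivity)]
    · congr 1
      rw [div_div]
      ring
    · exact ((intervalIntegrable_iff_integrableOn_Ioc_of_le hle).1 hi).const_mul _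
    · refine (ae_restrict_iff' measurableSet_Ioc).2 (Filter.Eventually.of_forall fun t ht => ?_)
      have : 0 < t := (by positivity : 0 < ε ^ 2).trans ht.1
      positivity
  have e3 : ∫⁻ t in Set.Ioi (1 / l), ENNReal.ofReal (l / (4 * Real.pi) * Real.exp (-l * t)) ≤
      ENNReal.ofReal (1 / (4 * Real.pi)) := by
    rw [← ofReal_integral_eq_lintegral_ofReal, integral_const_mul,
      integral_exp_mul_Ioi (by linarith)]
    · refine ENNReal.ofReal_le_ofReal ?_
      have : Real.exp (-l * (1 / l)) ≤ 1 := by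
        rw [Real.exp_le_one_iff, neg_mul]; exact neg_nonpos.2 (by positivity)
      calc l / (4 * Real.pi) * (-Real.exp (-l * (1 / l)) / -l)
          = 1 / (4 * Real.pi) * Real.exp (-l * (1 / l)) := by field_simp
        _ ≤ 1 / (4 * Real.pi) * 1 := by gcongr
        _ = _ := mul_one _
    · exact (integrableOn_exp_mul_Ioi (by linarith) _).const_mul _
    · exact Filter.Eventually.of_forall fun t => by positivity
  rw [e1, e2]
  refine (add_le_add le_rfl e3).trans (le_of_eq ?_)
  rw [← ENNReal.ofReal_add hM (by positivity), ← ENNReal.ofReal_add (by positivity) (by positivity)]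
  congr 1
  ring

/-! ### Time-ordered products -/

section TimeOrdered

variable {Φ : Plane → ℝ}

theorem measurable_pairKernel (hΦ : Measurable Φ) (ε : ℝ) :
    Measurable fun p : ℝ × Plane × Plane => pairKernel Φ ε p.1 p.2.1 p.2.2 := by
  have h1 : Measurable fun p : ℝ × Plane × Plane => hk (2 * p.1) (ε • (p.2.1 - p.2.2)) :=
    Measurable.comp (g := fun p : ℝ × Plane => hk p.1 p.2)
      (f := fun p : ℝ × Plane × Plane => (2 * p.1, ε • (p.2.1 - p.2.2))) measurable_hk (by fun_prop)
  have h2 := measurable_phi hΦ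
  unfold pairKernel
  fun_prop

theorem pairPow_succ (Φ : Plane → ℝ) (ε : ℝ) (m : ℕ) (t : ℝ) (y y' : Plane) :
    pairPow Φ ε (m + 1) t y y' = ∫⁻ s in Set.Ioo 0 t, ∫⁻ z : Plane,
      pairKernel Φ ε s y z * pairPow Φ ε m (t - s) z y' := rfl

theorem measurable_pairPow (hΦ : Measurable Φ) (ε : ℝ) (m : ℕ) :
    Measurable fun p : ℝ × Plane × Plane => pairPow Φ ε m p.1 p.2.1 p.2.2 := by
  induction m with
  | zero => exact measurable_pairKernel hΦ ε
  | succ m ih =>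
    have hF : Measurable fun q : ((ℝ × Plane × Plane) × ℝ) × Plane =>
        pairKernel Φ ε q.1.2 q.1.1.2.1 q.2 *
          pairPow Φ ε m (q.1.1.1 - q.1.2) q.2 q.1.1.2.2 :=
      (Measurable.comp (g := fun p : ℝ × Plane × Plane => pairKernel Φ ε p.1 p.2.1 p.2.2)
        (f := fun q : ((ℝ × Plane × Plane) × ℝ) × Plane => (q.1.2, q.1.1.2.1, q.2))
        (measurable_pairKernel hΦ ε) (by fun_prop)).mul
      (Measurable.comp (g := fun p : ℝ × Plane × Plane => pairPow Φ ε m p.1 p.2.1 p.2.2)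
        (f := fun q : ((ℝ × Plane × Plane) × ℝ) × Plane => (q.1.1.1 - q.1.2, q.2, q.1.1.2.2))
        ih (by fun_prop))
    have hG : Measurable fun q : (ℝ × Plane × Plane) × ℝ => ∫⁻ z : Plane,
        pairKernel Φ ε q.2 q.1.2.1 z * pairPow Φ ε m (q.1.1 - q.2) z q.1.2.2 :=
      hF.lintegral_prod_right'
    have hset : MeasurableSet {q : (ℝ × Plane × Plane) × ℝ | q.2 ∈ Set.Ioo 0 q.1.1} := by
      simp only [Set.mem_Ioo]
      exact (measurableSet_lt measurable_const measurable_snd).inter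
        (measurableSet_lt measurable_snd (measurable_fst.comp measurable_fst))
    convert (hG.indicator hset).lintegral_prod_right' (ν := volume) using 2 with p
    rw [pairPow_succ, ← lintegral_indicator measurableSet_Ioo]
    rfl

theorem measurable_pairKernel_comp (hΦ : Measurable Φ) (ε : ℝ) {Z : Type*} [MeasurableSpace Z]
    {s : Z → ℝ} {y y' : Z → Plane} (hs : Measurable s) (hy : Measurable y) (hy' : Measurable y') :
    Measurable fun z => pairKernel Φ ε (s z) (y z) (y' z) :=
  Measurable.comp (g := fun p : ℝ × Plane × Plane => pairKernel Φ ε p.1 p.2.1 p.2.2)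
    (f := fun z => (s z, y z, y' z)) (measurable_pairKernel hΦ ε) (hs.prodMk (hy.prodMk hy'))

theorem measurable_pairPow_comp (hΦ : Measurable Φ) (ε : ℝ) (m : ℕ) {Z : Type*}
    [MeasurableSpace Z] {s : Z → ℝ} {y y' : Z → Plane} (hs : Measurable s) (hy : Measurable y)
    (hy' : Measurable y') : Measurable fun z => pairPow Φ ε m (s z) (y z) (y' z) :=
  Measurable.comp (g := fun p : ℝ × Plane × Plane => pairPow Φ ε m p.1 p.2.1 p.2.2)
    (f := fun z => (s z, y z, y' z)) (measurable_pairPow hΦ ε m) (hs.prodMk (hy.prodMk hy'))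

section Bounds

variable {ε : ℝ} {E γ : ℝ → ℝ≥0∞} (hΦ : Measurable Φ) (hE : ∀ s t, E s * E (t - s) = E t)
  (hEt : ∀ t, E t ≠ ⊤)
include hΦ hE hEt

/-- If one factor maps φ to at most a scalar times φ, a product of factors does so with the product
of the scalars. The multiplicative part `E` comes out of the time integral, and γ is convolved, over
the whole line instead of (0, t). -/
theorem lintegral_pairPow_mul_phi_le
    (hk : ∀ t y, ∫⁻ y', pairKernel Φ ε t y y' * ENNReal.ofReal (phi Φ y') ≤
      ENNReal.ofReal (phi Φ y) * (E t * γ t)) (m : ℕ) (t : ℝ) (y : Plane) :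
    ∫⁻ y', pairPow Φ ε m t y y' * ENNReal.ofReal (phi Φ y') ≤
      ENNReal.ofReal (phi Φ y) * (E t * convPow γ m t) := by
  have hφ := (measurable_phi hΦ).ennreal_ofReal
  induction m generalizing t y with
  | zero => exact hk t y
  | succ m ih =>
    have hs : ∀ s, ∫⁻ y', (∫⁻ z, pairKernel Φ ε s y z * pairPow Φ ε m (t - s) z y') *
        ENNReal.ofReal (phi Φ y') ≤
          ENNReal.ofReal (phi Φ y) * E t * (γ s * convPow γ m (t - s)) := fun s => by
      calc _ = ∫⁻ y', ∫⁻ z, pairKernel Φ ε s y z * pairPow Φ ε m (t - s) z y' *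
            ENNReal.ofReal (phi Φ y') :=
            lintegral_congr fun y' => (lintegral_mul_const' _ _ ENNReal.ofReal_ne_top).symm
        _ = ∫⁻ z, ∫⁻ y', pairKernel Φ ε s y z * pairPow Φ ε m (t - s) z y' *
            ENNReal.ofReal (phi Φ y') := by
            refine lintegral_lintegral_swap (Measurable.aemeasurable ?_)
            exact ((measurable_pairKernel_comp hΦ ε measurable_const measurable_const
              measurable_snd).mul (measurable_pairPow_comp hΦ ε m measurable_const
              measurable_snd measurable_fst)).mul (hφ.comp measurable_fst)
        _ = ∫⁻ z, pairKernel Φ ε s y z *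
            ∫⁻ y', pairPow Φ ε m (t - s) z y' * ENNReal.ofReal (phi Φ y') := by
            refine lintegral_congr fun z => ?_
            simp_rw [mul_assoc]
            exact lintegral_const_mul' _ _ ENNReal.ofReal_ne_top
        _ ≤ ∫⁻ z, pairKernel Φ ε s y z * (ENNReal.ofReal (phi Φ z) *
            (E (t - s) * convPow γ m (t - s))) := by gcongr with z; exact ih _ _
        _ = (∫⁻ z, pairKernel Φ ε s y z * ENNReal.ofReal (phi Φ z)) *
            (E (t - s) * convPow γ m (t - s)) := by
            simp_rw [← mul_assoc]
            rw [lintegral_mul_const, lintegral_mul_const]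
            · exact (measurable_pairKernel_comp hΦ ε measurable_const measurable_const
                measurable_id).mul hφ
            · exact ((measurable_pairKernel_comp hΦ ε measurable_const measurable_const
                measurable_id).mul hφ).mul_const _
        _ ≤ (ENNReal.ofReal (phi Φ y) * (E s * γ s)) * (E (t - s) * convPow γ m (t - s)) := by
            gcongr; exact hk s y
        _ = _ := by rw [← hE s t]; ring
    calc ∫⁻ y', pairPow Φ ε (m + 1) t y y' * ENNReal.ofReal (phi Φ y')
        = ∫⁻ y', ∫⁻ s in Set.Ioo 0 t,
            (∫⁻ z, pairKernel Φ ε s y z * pairPow Φ ε m (t - s) z y') *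
              ENNReal.ofReal (phi Φ y') :=
          lintegral_congr fun y' => (lintegral_mul_const' _ _ ENNReal.ofReal_ne_top).symm
      _ = ∫⁻ s in Set.Ioo 0 t, ∫⁻ y',
            (∫⁻ z, pairKernel Φ ε s y z * pairPow Φ ε m (t - s) z y') *
              ENNReal.ofReal (phi Φ y') := by
          refine lintegral_lintegral_swap (Measurable.aemeasurable ?_)
          have h : Measurable fun q : (Plane × ℝ) × Plane =>
              pairKernel Φ ε q.1.2 y q.2 * pairPow Φ ε m (t - q.1.2) q.2 q.1.1 :=
            (measurable_pairKernel_comp hΦ ε (measurable_snd.comp measurable_fst)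
              measurable_const measurable_snd).mul (measurable_pairPow_comp hΦ ε m
              (measurable_const.sub (measurable_snd.comp measurable_fst)) measurable_snd
              (measurable_fst.comp measurable_fst))
          exact h.lintegral_prod_right'.mul (hφ.comp measurable_fst)
      _ ≤ ∫⁻ s in Set.Ioo 0 t,
            ENNReal.ofReal (phi Φ y) * E t * (γ s * convPow γ m (t - s)) :=
          lintegral_mono fun s => hs s
      _ ≤ ∫⁻ s, ENNReal.ofReal (phi Φ y) * E t * (γ s * convPow γ m (t - s)) :=
          setLIntegral_le_lintegral _ _
      _ = ENNReal.ofReal (phi Φ y) * (E t * convPow γ (m + 1) t) := by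
          rw [lintegral_const_mul' _ _ (ENNReal.mul_ne_top ENNReal.ofReal_ne_top (hEt t)),
            mul_assoc]
          rfl

/-- The transposed estimate. The recursion always splits off the leftmost factor, so here the
one-factor bound acts before the induction hypothesis. -/
theorem lintegral_phi_mul_pairPow_le
    (hk : ∀ t y', ∫⁻ y, ENNReal.ofReal (phi Φ y) * pairKernel Φ ε t y y' ≤
      ENNReal.ofReal (phi Φ y') * (E t * γ t)) (m : ℕ) (t : ℝ) (y' : Plane) :
    ∫⁻ y, ENNReal.ofReal (phi Φ y) * pairPow Φ ε m t y y' ≤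
      ENNReal.ofReal (phi Φ y') * (E t * convPow γ m t) := by
  have hφ := (measurable_phi hΦ).ennreal_ofReal
  induction m generalizing t y' with
  | zero => exact hk t y'
  | succ m ih =>
    have hs : ∀ s, ∫⁻ y, ENNReal.ofReal (phi Φ y) *
        (∫⁻ z, pairKernel Φ ε s y z * pairPow Φ ε m (t - s) z y') ≤
          ENNReal.ofReal (phi Φ y') * E t * (γ s * convPow γ m (t - s)) := fun s => by
      have hmP : Measurable fun z => pairPow Φ ε m (t - s) z y' :=
        measurable_pairPow_comp hΦ ε m measurable_const measurable_id measurable_const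
      calc _ = ∫⁻ y, ∫⁻ z, ENNReal.ofReal (phi Φ y) *
            (pairKernel Φ ε s y z * pairPow Φ ε m (t - s) z y') :=
            lintegral_congr fun y => (lintegral_const_mul' _ _ ENNReal.ofReal_ne_top).symm
        _ = ∫⁻ z, ∫⁻ y, ENNReal.ofReal (phi Φ y) *
            (pairKernel Φ ε s y z * pairPow Φ ε m (t - s) z y') := by
            refine lintegral_lintegral_swap (Measurable.aemeasurable ?_)
            exact (hφ.comp measurable_fst).mul ((measurable_pairKernel_comp hΦ ε
              measurable_const measurable_fst measurable_snd).mul (hmP.comp measurable_snd))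
        _ = ∫⁻ z, (∫⁻ y, ENNReal.ofReal (phi Φ y) * pairKernel Φ ε s y z) *
            pairPow Φ ε m (t - s) z y' := by
            refine lintegral_congr fun z => ?_
            simp_rw [← mul_assoc]
            rw [lintegral_mul_const]
            exact hφ.mul (measurable_pairKernel_comp hΦ ε measurable_const measurable_id
              measurable_const)
        _ ≤ ∫⁻ z, ENNReal.ofReal (phi Φ z) * (E s * γ s) * pairPow Φ ε m (t - s) z y' := by
            gcongr with z; exact hk s z
        _ = (E s * γ s) * ∫⁻ z, ENNReal.ofReal (phi Φ z) * pairPow Φ ε m (t - s) z y' := by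
            rw [← lintegral_const_mul _ (by exact hφ.mul hmP)]
            refine lintegral_congr fun z => by ring
        _ ≤ (E s * γ s) * (ENNReal.ofReal (phi Φ y') * (E (t - s) * convPow γ m (t - s))) := by
            gcongr; exact ih _ _
        _ = _ := by rw [← hE s t]; ring
    calc ∫⁻ y, ENNReal.ofReal (phi Φ y) * pairPow Φ ε (m + 1) t y y'
        = ∫⁻ y, ∫⁻ s in Set.Ioo 0 t, ENNReal.ofReal (phi Φ y) *
            (∫⁻ z, pairKernel Φ ε s y z * pairPow Φ ε m (t - s) z y') :=
          lintegral_congr fun y => (lintegral_const_mul' _ _ ENNReal.ofReal_ne_top).symm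
      _ = ∫⁻ s in Set.Ioo 0 t, ∫⁻ y, ENNReal.ofReal (phi Φ y) *
            (∫⁻ z, pairKernel Φ ε s y z * pairPow Φ ε m (t - s) z y') := by
          refine lintegral_lintegral_swap (Measurable.aemeasurable ?_)
          have h : Measurable fun q : (Plane × ℝ) × Plane =>
              pairKernel Φ ε q.1.2 q.1.1 q.2 * pairPow Φ ε m (t - q.1.2) q.2 y' :=
            (measurable_pairKernel_comp hΦ ε (measurable_snd.comp measurable_fst)
              (measurable_fst.comp measurable_fst) measurable_snd).mul
              (measurable_pairPow_comp hΦ ε m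
              (measurable_const.sub (measurable_snd.comp measurable_fst)) measurable_snd
              measurable_const)
          exact (hφ.comp measurable_fst).mul h.lintegral_prod_right'
      _ ≤ ∫⁻ s in Set.Ioo 0 t,
            ENNReal.ofReal (phi Φ y') * E t * (γ s * convPow γ m (t - s)) :=
          lintegral_mono fun s => hs s
      _ ≤ ∫⁻ s, ENNReal.ofReal (phi Φ y') * E t * (γ s * convPow γ m (t - s)) :=
          setLIntegral_le_lintegral _ _
      _ = ENNReal.ofReal (phi Φ y') * (E t * convPow γ (m + 1) t) := by
          rw [lintegral_const_mul' _ _ (ENNReal.mul_ne_top ENNReal.ofReal_ne_top (hEt t)),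
            mul_assoc]
          rfl

end Bounds

theorem pairKernel_eq_zero_of_left {ε t : ℝ} {y y' : Plane} (h : phi Φ y = 0) :
    pairKernel Φ ε t y y' = 0 := by simp [pairKernel, h]

theorem pairKernel_symm (Φ : Plane → ℝ) (ε t : ℝ) (y y' : Plane) :
    pairKernel Φ ε t y y' = pairKernel Φ ε t y' y := by
  rw [pairKernel, pairKernel, ← neg_sub y' y, smul_neg, hk_neg]
  ring_nf

/-- The Schur weights divide by φ; vanishing of the kernel where φ = 0 makes the required inequality
trivial there. -/
theorem pairPow_eq_zero_of_left {ε t : ℝ} {m : ℕ} {y y' : Plane} (h : phi Φ y = 0) :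
    pairPow Φ ε m t y y' = 0 := by
  cases m with
  | zero => exact pairKernel_eq_zero_of_left h
  | succ m => simp [pairPow_succ, pairKernel_eq_zero_of_left h]

theorem pairPow_eq_zero_of_right {ε t : ℝ} {m : ℕ} {y y' : Plane} (h : phi Φ y' = 0) :
    pairPow Φ ε m t y y' = 0 := by
  induction m generalizing t y with
  | zero => exact (pairKernel_symm Φ ε t y y').trans (pairKernel_eq_zero_of_left h)
  | succ m ih => simp [pairPow_succ, ih]

/-- The two-particle kernel is bounded by the mass of the rescaled heat kernel. -/
theorem lintegral_pairKernel_mul_phi_le (hΦ : Measurable Φ) (hΦ_nonneg : ∀ x, 0 ≤ Φ x)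
    (hΦ_int : ∫ x, Φ x = 1) {M : ℝ} (hM : ∀ x, Φ x ≤ M) {ε : ℝ} (hε : 0 < ε) (l t : ℝ)
    (y : Plane) :
    ∫⁻ y', pairKernel Φ ε t y y' * ENNReal.ofReal (phi Φ y') ≤
      ENNReal.ofReal (phi Φ y) *
        (ENNReal.ofReal (Real.exp (l * t)) * discounted l (M / ε ^ 2) t) := by
  have hM0 : 0 ≤ M := (hΦ_nonneg 0).trans (hM 0)
  by_cases ht : 0 < t
  swap
  -- For t ≤ 0 the formula for the heat kernel is nonpositive, and `ENNReal.ofReal` sends it to 0.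
  · have h0 : ∀ y', pairKernel Φ ε t y y' = 0 := fun y' => by
      rw [pairKernel, ENNReal.ofReal_eq_zero]
      refine mul_nonpos_of_nonpos_of_nonneg (mul_nonpos_of_nonneg_of_nonpos (phi_nonneg Φ _) ?_)
        (phi_nonneg Φ _)
      refine div_nonpos_of_nonneg_of_nonpos (Real.exp_pos _).le ?_
      push Not at ht
      have := Real.pi_pos
      nlinarith
    simp [h0]
  have hpi := Real.pi_pos
  have hΦm : Measurable fun y => ENNReal.ofReal (Φ y) := hΦ.ennreal_ofReal
  have hd : ENNReal.ofReal (Real.exp (l * t)) * discounted l (M / ε ^ 2) t =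
      ENNReal.ofReal (min (1 / (4 * Real.pi * t)) (M / ε ^ 2)) := by
    rw [discounted, Set.indicator_of_mem (show t ∈ Set.Ioi (0 : ℝ) from ht),
      ← ENNReal.ofReal_mul (Real.exp_pos _).le, ← mul_assoc, ← Real.exp_add, add_neg_cancel,
      Real.exp_zero, one_mul]
  have hker : ∀ y', pairKernel Φ ε t y y' * ENNReal.ofReal (phi Φ y') =
      ENNReal.ofReal (phi Φ y) *
        (ENNReal.ofReal (hk (2 * t) (ε • (y - y'))) * ENNReal.ofReal (Φ y')) := fun y' => by
    rw [pairKernel, ENNReal.ofReal_mul (mul_nonneg (phi_nonneg Φ _) (hk_nonneg (by positivity) _)),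
      ENNReal.ofReal_mul (phi_nonneg Φ _), mul_assoc, mul_assoc,
      ← ENNReal.ofReal_mul (phi_nonneg Φ _), ← sq, phi_sq hΦ_nonneg]
  simp_rw [hker]
  rw [lintegral_const_mul' _ _ ENNReal.ofReal_ne_top, hd]
  gcongr
  rw [ENNReal.ofReal_min]
  -- Either bound the heat kernel by its maximum and use the unit mass of Φ, or bound Φ by M and use
  -- the mass ε⁻² of the rescaled heat kernel.
  refine le_min ?_ ?_
  · calc ∫⁻ y', ENNReal.ofReal (hk (2 * t) (ε • (y - y'))) * ENNReal.ofReal (Φ y')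
        ≤ ∫⁻ y', ENNReal.ofReal (1 / (4 * Real.pi * t)) * ENNReal.ofReal (Φ y') := by
          gcongr with y'
          refine (hk_le (by positivity) _).trans (le_of_eq ?_)
          ring
      _ = _ := by
          rw [lintegral_const_mul _ hΦm, lintegral_ofReal_eq_one hΦ_nonneg hΦ_int, mul_one]
  · have hscale : ∀ x : Plane, hk (2 * t) (ε • x) = 1 / ε ^ 2 * hk (2 * t / ε ^ 2) x :=
      fun x => by
        unfold hk
        rw [norm_smul, Real.norm_of_nonneg hε.le]
        have : -(ε * ‖x‖) ^ 2 / (2 * (2 * t)) = -‖x‖ ^ 2 / (2 * (2 * t / ε ^ 2)) := by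
          field_simp
        rw [this]
        field_simp
    calc ∫⁻ y', ENNReal.ofReal (hk (2 * t) (ε • (y - y'))) * ENNReal.ofReal (Φ y')
        ≤ ∫⁻ y', ENNReal.ofReal (1 / ε ^ 2) * ENNReal.ofReal (hk (2 * t / ε ^ 2) (y - y')) *
            ENNReal.ofReal M := by
          gcongr with y'
          · rw [hscale, ENNReal.ofReal_mul (by positivity)]
          · exact hM y'
      _ = ENNReal.ofReal (M / ε ^ 2) := by
          rw [lintegral_mul_const' _ _ ENNReal.ofReal_ne_top,
            lintegral_const_mul' _ _ ENNReal.ofReal_ne_top, lintegral_hk_sub (by positivity),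
            mul_one, ← ENNReal.ofReal_mul (by positivity)]
          congr 1
          ring

/-- Every time-ordered product is bounded on `L²`, by a scalar convolution power. -/
theorem exists_pairPow_operator (hΦ : Measurable Φ) (hΦ_nonneg : ∀ x, 0 ≤ Φ x)
    (hΦ_int : ∫ x, Φ x = 1) {M : ℝ} (hM : ∀ x, Φ x ≤ M) {ε : ℝ} (hε : 0 < ε) (l t : ℝ) (m : ℕ)
    {a : ℝ} (ha0 : 0 ≤ a) (ha : convPow (discounted l (M / ε ^ 2)) m t ≤ ENNReal.ofReal a) :
    ∃ T : Lp ℂ 2 (volume : Measure Plane) →L[ℂ] Lp ℂ 2 (volume : Measure Plane),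
      HasKernel (pairPow Φ ε m t) T ∧ ‖T‖ ≤ Real.exp (l * t) * a := by
  have hφ := (measurable_phi hΦ).ennreal_ofReal
  have hE : ∀ s t, ENNReal.ofReal (Real.exp (l * s)) * ENNReal.ofReal (Real.exp (l * (t - s))) =
      ENNReal.ofReal (Real.exp (l * t)) := fun s t => by
    rw [← ENNReal.ofReal_mul (Real.exp_pos _).le, ← Real.exp_add]
    congr 2
    ring
  have hbase := lintegral_pairKernel_mul_phi_le hΦ hΦ_nonneg hΦ_int hM hε l
  have hbase' : ∀ t y', ∫⁻ y, ENNReal.ofReal (phi Φ y) * pairKernel Φ ε t y y' ≤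
      ENNReal.ofReal (phi Φ y') *
        (ENNReal.ofReal (Real.exp (l * t)) * discounted l (M / ε ^ 2) t) := fun t y' => by
    refine le_trans (le_of_eq (lintegral_congr fun y => ?_)) (hbase t y')
    rw [pairKernel_symm, mul_comm]
  have hR : ENNReal.ofReal (Real.exp (l * t)) * convPow (discounted l (M / ε ^ 2)) m t ≤
      ENNReal.ofReal (Real.exp (l * t) * a) := by
    rw [ENNReal.ofReal_mul (Real.exp_pos _).le]
    gcongr
  have hP : Measurable (Function.uncurry (pairPow Φ ε m t)) :=
    measurable_pairPow_comp hΦ ε m measurable_const measurable_fst measurable_snd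
  have hφ1 : Measurable fun p : Plane × Plane => ENNReal.ofReal (phi Φ p.1) :=
    hφ.comp measurable_fst
  have hφ2 : Measurable fun p : Plane × Plane => ENNReal.ofReal (phi Φ p.2) :=
    hφ.comp measurable_snd
  have hle : ∀ y y', pairPow Φ ε m t y y' ^ 2 ≤
      (pairPow Φ ε m t y y' * ENNReal.ofReal (phi Φ y') / ENNReal.ofReal (phi Φ y)) *
      (ENNReal.ofReal (phi Φ y) * pairPow Φ ε m t y y' / ENNReal.ofReal (phi Φ y')) :=
    fun y y' => by
    rcases (phi_nonneg Φ y).eq_or_lt with h | h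
    · simp [pairPow_eq_zero_of_left h.symm]
    rcases (phi_nonneg Φ y').eq_or_lt with h' | h'
    · simp [pairPow_eq_zero_of_right h'.symm]
    have c1 : ENNReal.ofReal (phi Φ y) * (ENNReal.ofReal (phi Φ y))⁻¹ = 1 :=
      ENNReal.mul_inv_cancel (by simpa using h) ENNReal.ofReal_ne_top
    have c2 : ENNReal.ofReal (phi Φ y') * (ENNReal.ofReal (phi Φ y'))⁻¹ = 1 :=
      ENNReal.mul_inv_cancel (by simpa using h') ENNReal.ofReal_ne_top
    refine le_of_eq ?_
    rw [div_eq_mul_inv, div_eq_mul_inv]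
    calc pairPow Φ ε m t y y' ^ 2 = pairPow Φ ε m t y y' ^ 2 *
          (ENNReal.ofReal (phi Φ y) * (ENNReal.ofReal (phi Φ y))⁻¹) *
          (ENNReal.ofReal (phi Φ y') * (ENNReal.ofReal (phi Φ y'))⁻¹) := by
          rw [c1, c2, mul_one, mul_one]
      _ = _ := by ring
  have hdiv : ∀ (w : Plane) (R I : ℝ≥0∞), I ≤ ENNReal.ofReal (phi Φ w) * R →
      I / ENNReal.ofReal (phi Φ w) ≤ R := fun w R I h =>
    ENNReal.div_le_of_le_mul' h
  have h1 : ∀ y, ∫⁻ y', pairPow Φ ε m t y y' * ENNReal.ofReal (phi Φ y') /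
      ENNReal.ofReal (phi Φ y) ≤ ENNReal.ofReal (Real.exp (l * t) * a) := fun y => by
    simp_rw [div_eq_mul_inv]
    rw [lintegral_mul_const _ (by exact (hP.of_uncurry_left (x := y)).mul hφ), ← div_eq_mul_inv]
    exact (hdiv _ _ _ (lintegral_pairPow_mul_phi_le hΦ hE (fun _ => ENNReal.ofReal_ne_top)
      hbase m t y)).trans hR
  have h2 : ∀ y', ∫⁻ y, ENNReal.ofReal (phi Φ y) * pairPow Φ ε m t y y' /
      ENNReal.ofReal (phi Φ y') ≤ ENNReal.ofReal (Real.exp (l * t) * a) := fun y' => by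
    simp_rw [div_eq_mul_inv]
    rw [lintegral_mul_const _ (by exact hφ.mul (hP.of_uncurry_right (y := y'))), ← div_eq_mul_inv]
    exact (hdiv _ _ _ (lintegral_phi_mul_pairPow_le hΦ hE (fun _ => ENNReal.ofReal_ne_top)
      hbase' m t y')).trans hR
  obtain ⟨T, hT, hTn⟩ := exists_operator_of_schur
    (K₁ := fun y y' =>
      pairPow Φ ε m t y y' * ENNReal.ofReal (phi Φ y') / ENNReal.ofReal (phi Φ y))
    (K₂ := fun y y' =>
      ENNReal.ofReal (phi Φ y) * pairPow Φ ε m t y y' / ENNReal.ofReal (phi Φ y'))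
    hP ((hP.mul hφ2).div hφ1) ((hφ1.mul hP).div hφ2) hle (by positivity) (by positivity) h1 h2
  exact ⟨T, hT, hTn.trans (le_of_eq (Real.sqrt_mul_self (by positivity)))⟩

end TimeOrdered

/-! ### Summation of the series -/

section Series

variable {Φ : Plane → ℝ}

/-- The scalar series majorizes the operator series term by term, which gives convergence in norm
and the bound at once. -/
theorem exists_isJ (hΦ : Measurable Φ) (hΦ_nonneg : ∀ x, 0 ≤ Φ x)
    (hΦ_int : ∫ x, Φ x = 1) {M : ℝ} (hM : ∀ x, Φ x ≤ M) (θ : ℝ) {ε : ℝ} (hε : 0 < ε) (l t : ℝ)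
    (hβ : 0 ≤ beta Φ θ ε) {a : ℕ → ℝ} (ha0 : ∀ m, 0 ≤ a m)
    (ha : ∀ m, convPow (discounted l (M / ε ^ 2)) m t ≤ ENNReal.ofReal (a m)) {s : ℝ}
    (hs : HasSum (fun m => beta Φ θ ε ^ (m + 2) * a m) s) :
    ∃ J : Lp ℂ 2 (volume : Measure Plane) →L[ℂ] Lp ℂ 2 (volume : Measure Plane),
      IsJ Φ θ ε t J ∧ ‖J‖ ≤ Real.exp (l * t) * s := by
  choose A hA hAn using fun m =>
    exists_pairPow_operator hΦ hΦ_nonneg hΦ_int hM hε l t m (ha0 m) (ha m)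
  have hb : ∀ m, ‖((beta Φ θ ε ^ (m + 2) : ℝ) : ℂ) • A m‖ ≤
      Real.exp (l * t) * (beta Φ θ ε ^ (m + 2) * a m) := fun m => by
    rw [norm_smul, Complex.norm_real, Real.norm_of_nonneg (by positivity), mul_left_comm]
    gcongr
    exact hAn m
  have hs' := hs.mul_left (Real.exp (l * t))
  have hsum : Summable fun m => ((beta Φ θ ε ^ (m + 2) : ℝ) : ℂ) • A m :=
    Summable.of_norm_bounded hs'.summable hb
  exact ⟨_, ⟨A, hA, hsum.hasSum⟩, tsum_of_norm_bounded hs' hb⟩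

/-- The two bounds on `j^ε(t)` in terms of the spectral gap `1 / β - I`. -/
theorem exists_isJ_of_gap (hΦ : Measurable Φ) (hΦ_nonneg : ∀ x, 0 ≤ Φ x)
    (hΦ_int : ∫ x, Φ x = 1) {M : ℝ} (hM : ∀ x, Φ x ≤ M) (θ : ℝ) {ε : ℝ} (hε : 0 < ε) {l t : ℝ}
    (hl : 0 ≤ l) (ht : 0 < t) (hβ : 0 < beta Φ θ ε) {I δ : ℝ} (hI0 : 0 ≤ I)
    (hI : ∫⁻ t, discounted l (M / ε ^ 2) t ≤ ENNReal.ofReal I) (hδ : 0 < δ)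
    (hgap : δ ≤ 1 / beta Φ θ ε - I) {D : ℝ}
    (hD : 1 / (4 * Real.pi * t) ≤ D ∨ M / ε ^ 2 ≤ D) :
    ∃ J : Lp ℂ 2 (volume : Measure Plane) →L[ℂ] Lp ℂ 2 (volume : Measure Plane),
      IsJ Φ θ ε t J ∧ ‖J‖ ≤ Real.exp (l * t) * (D / δ ^ 2) := by
  set β := beta Φ θ ε with hβdef
  have hpi := Real.pi_pos
  have hb0 : 0 ≤ M / ε ^ 2 := div_nonneg ((hΦ_nonneg 0).trans (hM 0)) (by positivity)
  have hD0 : 0 ≤ D := hD.elim (fun h => le_trans (by positivity) h) (fun h => hb0.trans h)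
  have hg := measurable_discounted l (M / ε ^ 2)
  have hδβ : δ * β ≤ 1 - β * I := by
    have h := mul_le_mul_of_nonneg_right hgap hβ.le
    rw [sub_mul, one_div, inv_mul_cancel₀ hβ.ne'] at h
    linarith
  have hpos : 0 < 1 - β * I := (mul_pos hδ hβ).trans_le hδβ
  have hr0 : 0 ≤ β * I := by positivity
  have hr1 : ‖β * I‖ < 1 := by rw [Real.norm_of_nonneg hr0]; linarith
  -- The first alternative for D uses size biasing, the second the supremum bound. The latter has no
  -- factor m + 1; inserting it lets one series treat both.
  have hconv : ∀ m, convPow (discounted l (M / ε ^ 2)) m t ≤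
      ENNReal.ofReal ((m + 1) * (D * I ^ m)) := fun m => by
    rcases hD with h | h
    · have h1 := ofReal_mul_convPow_le hg (ofReal_mul_discounted_le hl hb0) m t
      have h2 : ENNReal.ofReal t * convPow (discounted l (M / ε ^ 2)) m t ≤
          ENNReal.ofReal t * ENNReal.ofReal ((m + 1) * (D * I ^ m)) := by
        refine h1.trans ?_
        rw [← ENNReal.ofReal_mul ht.le]
        calc _ ≤ ENNReal.ofReal (m + 1) * ENNReal.ofReal (1 / (4 * Real.pi)) *
              ENNReal.ofReal I ^ m := by
              gcongr
              rw [ENNReal.ofReal_add (by positivity) (by positivity)]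
              simp
          _ = ENNReal.ofReal ((m + 1) * (1 / (4 * Real.pi)) * I ^ m) := by
              rw [← ENNReal.ofReal_pow hI0, ← ENNReal.ofReal_mul (by positivity),
                ← ENNReal.ofReal_mul (by positivity)]
          _ ≤ _ := by
              refine ENNReal.ofReal_le_ofReal ?_
              have : 1 / (4 * Real.pi) ≤ t * D := by
                refine le_trans (le_of_eq ?_) (mul_le_mul_of_nonneg_left h ht.le)
                field_simp
              calc (m + 1 : ℝ) * (1 / (4 * Real.pi)) * I ^ m ≤ (m + 1) * (t * D) * I ^ m := by
                    gcongr
                _ = _ := by ring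
      rwa [ENNReal.mul_le_mul_iff_right (by simpa using ht) ENNReal.ofReal_ne_top] at h2
    · calc _ ≤ ENNReal.ofReal (M / ε ^ 2) * (∫⁻ t, discounted l (M / ε ^ 2) t) ^ m :=
            convPow_le hg (discounted_le hl hb0) m t
        _ ≤ ENNReal.ofReal D * ENNReal.ofReal I ^ m := by gcongr
        _ ≤ _ := by
            rw [← ENNReal.ofReal_pow hI0, ← ENNReal.ofReal_mul hD0]
            refine ENNReal.ofReal_le_ofReal ?_
            have : (1 : ℝ) ≤ m + 1 := by simp
            exact le_mul_of_one_le_left (by positivity) this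
  have hsum : HasSum (fun m : ℕ => β ^ (m + 2) * ((m + 1) * (D * I ^ m)))
      (β ^ 2 * D * (1 / (1 - β * I) ^ 2)) := by
    -- The series of (m + 1) r^m is 1/(1 - r)², with r = βI < 1. Multiplied by β² it becomes (1/β -
    -- I)⁻².
    have h := (hasSum_choose_mul_geometric_of_norm_lt_one 1 hr1).mul_left (β ^ 2 * D)
    have hf : (fun m : ℕ => β ^ (m + 2) * ((m + 1) * (D * I ^ m))) =
        fun m : ℕ => β ^ 2 * D * (((m + 1).choose 1 : ℕ) * (β * I) ^ m) := by
      funext m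
      rw [Nat.choose_one_right]
      push_cast
      ring
    rw [hf]
    exact h
  obtain ⟨J, hJ, hJn⟩ := exists_isJ hΦ hΦ_nonneg hΦ_int hM θ hε l t hβ.le
    (fun m => by positivity) hconv hsum
  refine ⟨J, hJ, hJn.trans ?_⟩
  gcongr
  rw [mul_one_div, div_le_div_iff₀ (by positivity) (by positivity)]
  calc β ^ 2 * D * δ ^ 2 = D * (δ * β) ^ 2 := by ring
    _ ≤ D * (1 - β * I) ^ 2 := by gcongr

/-- A lower bound on the inverse of the coupling constant. -/
theorem one_div_coupling_ge {E κ : ℝ} (hE : 0 < E) (hκ : 0 < 2 * E + κ) :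
    0 < 2 * Real.pi / E + Real.pi / E ^ 2 * κ ∧
      (2 * E - κ) / (4 * Real.pi) ≤ 1 / (2 * Real.pi / E + Real.pi / E ^ 2 * κ) := by
  have hpi := Real.pi_pos
  have h : 2 * Real.pi / E + Real.pi / E ^ 2 * κ = Real.pi * (2 * E + κ) / E ^ 2 := by
    field_simp
  rw [h]
  refine ⟨by positivity, ?_⟩
  rw [one_div_div, div_le_div_iff₀ (by positivity) (by positivity)]
  -- After clearing denominators this is (2E - κ)(2E + κ) ≤ 4E².
  nlinarith [mul_nonneg hpi.le (sq_nonneg κ)]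

/-- Up to a constant, t log² t is increasing near 0. With t = (εq)² and q ≤ 1, the claim reduces to
q (E + log(1/q)) ≤ 2E, which follows from q log(1/q) ≤ 1 ≤ E. -/
theorem mul_sq_log_le {ε t : ℝ} (hε : 0 < ε) (ht : 0 < t) (htε : t ≤ ε ^ 2)
    (hE : 1 ≤ -Real.log ε) : t * Real.log t ^ 2 ≤ 16 * (ε ^ 2 * Real.log ε ^ 2) := by
  set E := -Real.log ε with hEdef
  obtain ⟨q, hq0, hq⟩ : ∃ q, 0 < q ∧ t = (ε * q) ^ 2 :=
    ⟨√t / ε, by positivity, by rw [mul_div_cancel₀ _ hε.ne', Real.sq_sqrt ht.le]⟩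
  have hq1 : q ≤ 1 := by
    rw [hq, mul_pow] at htε
    have : q ^ 2 ≤ 1 := by
      have h : ε ^ 2 * q ^ 2 ≤ ε ^ 2 * 1 := by linarith
      exact le_of_mul_le_mul_left h (by positivity)
    nlinarith
  have hlog : Real.log t = -(2 * (E + Real.log q⁻¹)) := by
    rw [hq, Real.log_pow, Real.log_mul hε.ne' hq0.ne', Real.log_inv]
    push_cast
    ring
  have hl0 : 0 ≤ Real.log q⁻¹ := Real.log_nonneg ((one_le_inv₀ hq0).2 hq1)
  have hql : q * Real.log q⁻¹ ≤ 1 := by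
    have h1 := Real.log_le_sub_one_of_pos (inv_pos.2 hq0)
    calc q * Real.log q⁻¹ ≤ q * (q⁻¹ - 1) := by gcongr
      _ = 1 - q := by field_simp
      _ ≤ 1 := by linarith
  have hkey : q * (2 * (E + Real.log q⁻¹)) ≤ 4 * E := by nlinarith
  have h2 : Real.log ε ^ 2 = E ^ 2 := by rw [hEdef, neg_sq]
  rw [h2, hlog, hq]
  calc (ε * q) ^ 2 * (-(2 * (E + Real.log q⁻¹))) ^ 2
      = ε ^ 2 * (q * (2 * (E + Real.log q⁻¹))) ^ 2 := by ring
    _ ≤ ε ^ 2 * (4 * E) ^ 2 := by gcongr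
    _ = _ := by ring

/-- The bound on `j^ε(t)`, uniformly in small `ε`. -/
theorem exists_isJ_norm_le (hΦ : Measurable Φ) (hΦ_nonneg : ∀ x, 0 ≤ Φ x)
    (hΦ_int : ∫ x, Φ x = 1) {M : ℝ} (hM : ∀ x, Φ x ≤ M) (θ : ℝ) :
    ∃ c₀ : ℝ, 0 < c₀ ∧ ∀ c : ℝ, c₀ ≤ c → ∀ ε : ℝ, 0 < ε → ε ≤ 1 / c → ∀ t : ℝ, 0 < t →
      ∃ J : Lp ℂ 2 (volume : Measure Plane) →L[ℂ] Lp ℂ 2 (volume : Measure Plane),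
        IsJ Φ θ ε t J ∧
          ‖J‖ ≤ c * t⁻¹ * (|Real.log (min t (1 / 2))| ^ 2)⁻¹ * Real.exp (c * t) := by
  set κ := θ - 2 * Real.log 2 + 2 * Real.eulerMascheroniConstant +
    2 * ∫ p : Plane × Plane, Φ p.1 * Real.log ‖p.1 - p.2‖ * Φ p.2 with hκ
  have hpi := Real.pi_pos
  have hM0 : 0 ≤ M := (hΦ_nonneg 0).trans (hM 0)
  -- R dominates all bounded terms in 4π(1/β - I); L = e^(2R) ensures that they use up at most half
  -- of log l when l ≥ L.
  set R := |κ| + 4 * Real.pi * M + 1 with hR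
  have hR1 : 1 ≤ R := by
    have := abs_nonneg κ
    have : 0 ≤ 4 * Real.pi * M := by positivity
    linarith
  set L := Real.exp (2 * R) with hL
  have hLpos : 0 < L := Real.exp_pos _
  have hL2 : 2 ≤ L := by
    have := Real.add_one_le_exp (2 * R)
    linarith
  have hlogL : Real.log L = 2 * R := Real.log_exp _
  have hA : 0 ≤ 16 * Real.pi * Real.exp 1 := by positivity
  have hB : 0 ≤ 256 * Real.pi ^ 2 * Real.exp 1 * M := by positivity
  -- The summands serve respectively the smallness of ε and the exponential rate, the range with l =
  -- max(1/t, L), and the range t ≤ ε².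
  refine ⟨L + 16 * Real.pi * Real.exp 1 + 256 * Real.pi ^ 2 * Real.exp 1 * M, by positivity,
    fun c hc ε hε hεc t ht => ?_⟩
  have hc1 : L ≤ c := by linarith
  have hc2 : 16 * Real.pi * Real.exp 1 ≤ c := by linarith
  have hc3 : 256 * Real.pi ^ 2 * Real.exp 1 * M ≤ c := by linarith
  have hcpos : 0 < c := hLpos.trans_le hc1
  have hεL : ε ≤ L⁻¹ := hεc.trans (by rw [one_div]; gcongr)
  have hε1 : ε ≤ 1 := hεL.trans (inv_le_one_of_one_le₀ (by linarith))
  set E := |Real.log ε| with hE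
  have hlogε : Real.log ε ≤ -(2 * R) := by
    rw [← hlogL, ← Real.log_inv]
    exact Real.log_le_log hε hεL
  have hEeq : E = -Real.log ε := abs_of_nonpos (by linarith)
  have hER : 2 * R ≤ E := by linarith
  have hβ := one_div_coupling_ge (E := E) (κ := κ) (by linarith)
    (by linarith [neg_abs_le κ, (by positivity : 0 ≤ 4 * Real.pi * M)])
  change 0 < beta Φ θ ε ∧ _ ≤ 1 / beta Φ θ ε at hβ
  -- For every admissible discount rate l the gap 1/β - I is at least log l/(8π); l remains free to
  -- depend on t.
  have key : ∀ l, L ≤ l → l * ε ^ 2 ≤ 1 → ∀ D : ℝ,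
      (1 / (4 * Real.pi * t) ≤ D ∨ M / ε ^ 2 ≤ D) →
      ∃ J : Lp ℂ 2 (volume : Measure Plane) →L[ℂ] Lp ℂ 2 (volume : Measure Plane),
        IsJ Φ θ ε t J ∧
          ‖J‖ ≤ Real.exp (l * t) * (D / (Real.log l / (8 * Real.pi)) ^ 2) := by
    intro l hl hlε D hD
    have hl0 : 0 < l := hLpos.trans_le hl
    have hlogl : 2 * R ≤ Real.log l := by rw [← hlogL]; exact Real.log_le_log hLpos hl
    have hlog : Real.log (1 / (l * ε ^ 2)) = 2 * E - Real.log l := by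
      rw [one_div, Real.log_inv, Real.log_mul hl0.ne' (by positivity), Real.log_pow, hEeq]
      push_cast
      ring
    have hlog0 : 0 ≤ Real.log (1 / (l * ε ^ 2)) :=
      Real.log_nonneg (by rw [le_div_iff₀ (by positivity)]; linarith)
    refine exists_isJ_of_gap hΦ hΦ_nonneg hΦ_int hM θ hε hl0.le ht hβ.1
      (by positivity) (lintegral_discounted_le hl0 hM0 hε hlε)
      (by apply div_pos <;> linarith) ?_ hD
    refine le_trans ?_ (sub_le_sub_right hβ.2 _)
    rw [hlog]
    have hκ' := le_abs_self κ
    -- The cancellation of 2|log ε| between the inverse coupling and the mass.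
    have : (2 * E - κ) / (4 * Real.pi) -
        (M + 1 / (4 * Real.pi) + (2 * E - Real.log l) / (4 * Real.pi)) =
        (Real.log l - (κ + 4 * Real.pi * M + 1)) / (4 * Real.pi) := by
      field_simp
      ring
    rw [this, div_le_div_iff₀ (by positivity) (by positivity)]
    nlinarith
  set τ := min t (1 / 2) with hτ
  have hτ0 : 0 < τ := lt_min ht (by norm_num)
  have hτ2 : τ ≤ 1 / 2 := min_le_right _ _
  have hlogτ : 0 < |Real.log τ| := abs_pos.2 (Real.log_neg hτ0 (by linarith)).ne
  have habs : |Real.log τ| = Real.log τ⁻¹ := by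
    rw [Real.log_inv, abs_of_neg (Real.log_neg hτ0 (by linarith))]
  -- The mass estimate requires l ε² ≤ 1, so l = max(1/t, L) is allowed only when t is not below ε².
  by_cases hcase : max (1 / t) L * ε ^ 2 ≤ 1
  · obtain ⟨J, hJ, hJn⟩ := key _ (le_max_right _ _) hcase (1 / (4 * Real.pi * t)) (Or.inl le_rfl)
    refine ⟨J, hJ, hJn.trans ?_⟩
    set l := max (1 / t) L with hl
    have hτl : τ⁻¹ ≤ l := by
      -- If the minimum is 1/2, its inverse 2 is covered by L ≥ 2.
      rcases min_choice t (1 / 2) with h | h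
      · rw [hτ, h, ← one_div]; exact le_max_left _ _
      · rw [hτ, h]
        refine le_trans ?_ (le_max_right _ _)
        norm_num
        exact hL2
    have hlog : |Real.log τ| ≤ Real.log l := by
      rw [habs]; exact Real.log_le_log (inv_pos.2 hτ0) hτl
    have hlt : l * t ≤ 1 + L * t := by
      have h0 : 0 < 1 / t := by positivity
      have : l ≤ 1 / t + L := max_le (by linarith) (by linarith)
      calc l * t ≤ (1 / t + L) * t := by gcongr
        _ = 1 + L * t := by field_simp
    calc Real.exp (l * t) * (1 / (4 * Real.pi * t) / (Real.log l / (8 * Real.pi)) ^ 2)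
        ≤ Real.exp (1 + L * t) *
            (1 / (4 * Real.pi * t) / (|Real.log τ| / (8 * Real.pi)) ^ 2) := by gcongr
      _ = (16 * Real.pi * Real.exp 1) * t⁻¹ * (|Real.log τ| ^ 2)⁻¹ * Real.exp (L * t) := by
          rw [Real.exp_add]
          field_simp
          ring
      _ ≤ c * t⁻¹ * (|Real.log τ| ^ 2)⁻¹ * Real.exp (c * t) := by gcongr
  · push Not at hcase
    have hLε : L ≤ 1 / ε ^ 2 := by
      rw [le_div_iff₀ (by positivity)]
      calc L * ε ^ 2 = L * ε * ε := by ring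
        _ ≤ L * L⁻¹ * 1 := by gcongr
        _ = 1 := by field_simp
    have htε : t ≤ ε ^ 2 := by
      rcases max_choice (1 / t) L with h | h
      · rw [h, div_mul_eq_mul_div, one_mul, lt_div_iff₀ ht, one_mul] at hcase
        exact hcase.le
      · rw [h] at hcase
        rw [le_div_iff₀ (by positivity)] at hLε
        linarith
    -- The largest admissible rate: the gap is of order |log ε| and e^(lt) ≤ e.
    obtain ⟨J, hJ, hJn⟩ := key (1 / ε ^ 2) hLε (by field_simp; rfl) (M / ε ^ 2) (Or.inr le_rfl)
    refine ⟨J, hJ, hJn.trans ?_⟩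
    have hτt : τ = t := by
      refine min_eq_left (htε.trans ?_)
      calc ε ^ 2 = ε * ε := sq ε
        _ ≤ L⁻¹ * 1 := by gcongr
        _ ≤ 1 / 2 := by rw [mul_one, one_div]; gcongr
    have hlog : Real.log (1 / ε ^ 2) = 2 * E := by
      rw [one_div, Real.log_inv, Real.log_pow, hEeq]
      push_cast
      ring
    have hE0 : 0 < E := by linarith
    have hexp : Real.exp (1 / ε ^ 2 * t) ≤ Real.exp 1 := by
      gcongr
      rw [div_mul_eq_mul_div, one_mul, div_le_one (by positivity)]
      exact htε
    have hmain := mul_sq_log_le hε ht htε (by linarith)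
    rw [← sq_abs (Real.log t), ← sq_abs (Real.log ε), ← hE] at hmain
    rw [hτt] at hlogτ ⊢
    have hinv : 1 / (ε ^ 2 * E ^ 2) ≤ 16 * (t⁻¹ * (|Real.log t| ^ 2)⁻¹) := by
      rw [← mul_inv, ← div_eq_mul_inv, div_le_div_iff₀ (by positivity) (by positivity)]
      linarith
    have hect : 1 ≤ Real.exp (c * t) := Real.one_le_exp (by positivity)
    rw [hlog]
    calc Real.exp (1 / ε ^ 2 * t) * (M / ε ^ 2 / (2 * E / (8 * Real.pi)) ^ 2)
        ≤ Real.exp 1 * (M / ε ^ 2 / (2 * E / (8 * Real.pi)) ^ 2) := by gcongr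
      _ = 16 * Real.pi ^ 2 * Real.exp 1 * M * (1 / (ε ^ 2 * E ^ 2)) := by
          field_simp
          ring
      _ ≤ 16 * Real.pi ^ 2 * Real.exp 1 * M * (16 * (t⁻¹ * (|Real.log t| ^ 2)⁻¹)) := by gcongr
      _ = (256 * Real.pi ^ 2 * Real.exp 1 * M) * t⁻¹ * (|Real.log t| ^ 2)⁻¹ * 1 := by ring
      _ ≤ c * t⁻¹ * (|Real.log t| ^ 2)⁻¹ * Real.exp (c * t) := by gcongr

end Series

end DeltaBose

/-! ### Assembly of the four bounds -/

theorem mainTheorem2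
    (Φ : DeltaBose.Plane → ℝ) (hΦ_smooth : ContDiff ℝ ∞ Φ) (hΦ_supp : HasCompactSupport Φ)
    (hΦ_nonneg : ∀ x, 0 ≤ Φ x) (hΦ_int : ∫ x, Φ x = 1) (θ : ℝ) (n : ℕ) :
    ∃ c : ℝ, 0 < c ∧ ∀ ε : ℝ, 0 < ε → ε ≤ 1 / c →
      (∀ t : ℝ, 0 < t → ∀ α : DeltaBose.Pair n,
        ∃ (T : Lp ℂ 2 (volume : Measure (DeltaBose.Config n)) →L[ℂ]
              Lp ℂ 2 (volume : Measure (DeltaBose.RelConfig α)))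
          (Tstar : Lp ℂ 2 (volume : Measure (DeltaBose.RelConfig α)) →L[ℂ]
              Lp ℂ 2 (volume : Measure (DeltaBose.Config n))),
          DeltaBose.HasKernel (DeltaBose.incoming Φ ε α t) T ∧
          DeltaBose.HasKernel (DeltaBose.incomingStar Φ ε α t) Tstar ∧
          ‖T‖ = ‖Tstar‖ ∧ ‖T‖ ≤ c * t ^ (-(1 / 2) : ℝ)) ∧
      (∀ t : ℝ, 0 < t → ∀ α α' : DeltaBose.Pair n,
        ∃ T : Lp ℂ 2 (volume : Measure (DeltaBose.RelConfig α')) →L[ℂ]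
              Lp ℂ 2 (volume : Measure (DeltaBose.RelConfig α)),
          DeltaBose.HasKernel (DeltaBose.swapping Φ ε α α' t) T ∧ ‖T‖ ≤ c * t⁻¹) ∧
      (∀ α α' : DeltaBose.Pair n, α ≠ α' →
        ∃ T : Lp ℂ 2 (volume : Measure (DeltaBose.RelConfig α')) →L[ℂ]
              Lp ℂ 2 (volume : Measure (DeltaBose.RelConfig α)),
          DeltaBose.HasKernel (DeltaBose.swappingLaplace Φ ε α α') T ∧ ‖T‖ ≤ c) ∧
      (∀ t : ℝ, 0 < t →
        ∃ J : Lp ℂ 2 (volume : Measure DeltaBose.Plane) →L[ℂ]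
              Lp ℂ 2 (volume : Measure DeltaBose.Plane),
          DeltaBose.IsJ Φ θ ε t J ∧
          ‖J‖ ≤ c * t⁻¹ * (|Real.log (min t (1 / 2))| ^ 2)⁻¹ * Real.exp (c * t)) := by
  have hΦ : Measurable Φ := hΦ_smooth.continuous.measurable
  obtain ⟨M, hM⟩ := hΦ_supp.exists_bound_of_continuous hΦ_smooth.continuous
  obtain ⟨c₁, hc₁, hLaplace⟩ := DeltaBose.exists_swappingLaplace
  obtain ⟨c₂, hc₂, hJ⟩ := DeltaBose.exists_isJ_norm_le hΦ hΦ_nonneg hΦ_int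
    (fun x => (Real.le_norm_self _).trans (hM x)) θ
  -- The summand 1 covers the incoming and swapping bounds, which hold with constant 1. Enlarging c
  -- is harmless for the series because its bound is proved for every c ≥ c₂.
  refine ⟨1 + c₁ + c₂, by positivity, fun ε hε hεc => ⟨fun t ht α => ?_, fun t ht α α' => ?_,
    fun α α' hne => ?_, fun t ht => ?_⟩⟩
  · obtain ⟨T, T', h1, h2, h3, h4⟩ := DeltaBose.exists_incoming hΦ hΦ_nonneg hΦ_int ε ht α
    exact ⟨T, T', h1, h2, h3, h4.trans (le_mul_of_one_le_left (by positivity) (by linarith))⟩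
  · obtain ⟨T, h1, h2⟩ := DeltaBose.exists_swapping hΦ hΦ_nonneg hΦ_int ε ht α α'
    exact ⟨T, h1, h2.trans (le_mul_of_one_le_left (by positivity) (by linarith))⟩
  · obtain ⟨T, h1, h2⟩ := hLaplace hΦ hΦ_nonneg hΦ_int ε α α' hne
    exact ⟨T, h1, h2.trans (by linarith)⟩
  · exact hJ (1 + c₁ + c₂) (by linarith) ε hε hεc t ht
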